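/- **Theorem 5.** Let $G$ be a finite directed acyclic graph whose $W$ vertices are unit tasks and whose edges are precedence constraints. Assume that $G$ has exactly one source and that every vertex has out-degree at most $2$, and let $D$ be its critical path, i.e. the largest number of edges on a directed path. The tasks are executed on $m\ge 1$ processors by the non-blocking work stealing of Arora, Blumofe and Plaxton (ABP): - Time is divided into slots. Each processor owns a double-ended queue of ready tasks. Initially one of these deques contains the source and the others are empty. - In a slot, a processor whose deque is non-empty at the beginning of the slot executes the task at the bottom of its deque, pops it, and pushes at the bottom the tasks which this execution enables. A task that becomes ready is enabled by exactly one of its predecessors executed in that slot; ties, and the order of the pushes, are arbitrary. - In a slot, each processor whose deque is empty at the beginning of the slot is a thief: independently of the past and of the other thieves, it chooses a victim uniformly at random among the $m-1$ other processors. If a victim receives at least one request and its deque contains at the beginning of the slot at least two tasks (one of them in execution), then its top-most task is moved to the deque of exactly one of the thieves requesting it (chosen by an arbitrary rule); all the other requests fail. - Arbitrary choices may depend on the past and on the current slot, but not on the victims drawn in later slots. Let $C_{\max}$ be the makespan, i.e. the number of slots until all tasks are executed. Then $C_{\max}$ is always finite and has a finite expectation, and (i) $\displaystyle \mathbb E[C_{\max}]\le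 \frac Wm+\frac{3}{1-\log_2(1+\frac1e)}\,D+1 ,$ where the right-hand side is $<\frac Wm+5.5\,D+1$ whenever $D\ge1$; moreover $\mathbb E[C_{\max}]<\frac Wm+5.5\,D+1$ for every $D\ge 0$; (ii) for every $\varepsilon>0$, $\displaystyle \mathbb P\Bigl(C_{\max}\ge \frac Wm+\frac{3}{1-\log_2(1+\frac1e)}\Bigl(D+\log_2\frac1\varepsilon\Bigr)+1\Bigr)\le\varepsilon .$ -/

import Mathlib

open MeasureTheory

namespace ABP

/-- `D` is the critical path (depth) of the precedence graph: the largest number of edges on a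
directed path. -/
def IsCriticalPath {V : Type*} (G : Digraph V) (D : ℕ) : Prop :=
  IsGreatest {n : ℕ | ∃ p : List V, p.IsChain G.Adj ∧ p.length = n + 1} D

/-- Configuration of the scheduler at the beginning of a time slot. Processor `i` owns the
double-ended queue `deque i`, listed from its bottom (head of the list) to its top (last entry). -/
structure State (m : ℕ) (V : Type*) where
  deque : Fin m → List V
  executed : Set V

namespace State

variable {m : ℕ} {V : Type*}

/-- Initially nothing is executed, one deque contains the source, the others are empty. -/
def IsInitial (root : V) (s : State m V) : Prop :=
  s.executed = ∅ ∧ ∃ p : Fin m, s.deque p = [root] ∧ ∀ i, i ≠ p → s.deque i = []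

/-- During the slot, processor `i` executes the task `u`, which is at the bottom of its deque. -/
def Executes (s : State m V) (i : Fin m) (u : V) : Prop :=
  ∃ rest, s.deque i = u :: rest

/-- The tasks that are executed once the slot is over. -/
def executedAfter (s : State m V) : Set V :=
  s.executed ∪ {u | ∃ i, s.Executes i u}

/-- The task `v` is made ready by the executions of this slot: the last of its predecessors are
executed in it. -/
def BecomesReady (G : Digraph V) (s : State m V) (v : V) : Prop :=
  (∃ i u, s.Executes i u ∧ G.Adj u v) ∧ ∀ u, G.Adj u v → u ∈ s.executedAfter

/-- `c i` lists the tasks enabled by the task that processor `i` executes in the slot. Every task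
that becomes ready is enabled by exactly one of its predecessors executed in the slot (which one,
if there are several, is left free, and so is the order of the list). -/
def IsEnabling (G : Digraph V) (s : State m V) (c : Fin m → List V) : Prop :=
  (∀ i, (c i).Nodup) ∧
  (∀ i, ∀ v ∈ c i, s.BecomesReady G v ∧ ∃ u, s.Executes i u ∧ G.Adj u v) ∧
  (∀ v, s.BecomesReady G v → ∃! i, v ∈ c i)

/-- When the victims are drawn according to `f`, processor `j` is a thief (its deque is empty) and
sends its steal request to processor `k`. -/
def Requests (s : State m V) (f : Fin m → Fin m) (j k : Fin m) : Prop :=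
  s.deque j = [] ∧ f j = k

/-- `winner k` is the one thief, among those who request work from `k`, that is served (which one
is left free; the value is irrelevant if nobody requests work from `k`). -/
def IsArbitration (s : State m V) (f winner : Fin m → Fin m) : Prop :=
  ∀ k, (∃ j, s.Requests f j k) → s.Requests f (winner k) k

/-- One time slot of the non-blocking work stealing of Arora, Blumofe and Plaxton, when the
victims drawn in the slot are given by `f`.

An active processor executes its bottom task, pops it and pushes the tasks that it enables at the
bottom; if it receives steal requests it loses the top-most of the other tasks of its deque,
if there is one. The served thief gets this task, every other thief stays idle. -/
def Step (G : Digraph V) (s : State m V) (f : Fin m → Fin m) (s' : State m V) : Prop :=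
  s'.executed = s.executedAfter ∧
  ∃ (c : Fin m → List V) (winner : Fin m → Fin m),
    s.IsEnabling G c ∧ s.IsArbitration f winner ∧
    (∀ i u rest, s.deque i = u :: rest →
      ((∃ j, s.Requests f j i) → s'.deque i = c i ++ rest.dropLast) ∧
      ((¬ ∃ j, s.Requests f j i) → s'.deque i = c i ++ rest)) ∧
    (∀ j, s.deque j = [] →
      (winner (f j) = j → s'.deque j = (s.deque (f j)).tail.getLast?.toList) ∧
      (winner (f j) ≠ j → s'.deque j = []))

end State

/-- `state t` (the configuration at the beginning of slot `t`) and `victim t` (the victims drawn in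
slot `t`; the draw of a processor is used only if it is a thief) form a random execution of work
stealing on `m` processors, `ℱ t` being the information available before the draws of slot `t`.

The last field says that, given `ℱ t`, the draws are independent of each other and the draw of each
processor is uniform among the `m - 1` other ones. The choices left free by `State.Step` can be made
by any rule, randomized or not, that does not know the draws of later slots. -/
structure IsExecution {Ω V : Type*} {mΩ : MeasurableSpace Ω} {m : ℕ} (μ : Measure Ω)
    (ℱ : Filtration ℕ mΩ) (G : Digraph V) (root : V)
    (state : ℕ → Ω → State m V) (victim : ℕ → Ω → Fin m → Fin m) : Prop where
  initial : ∀ ω, (state 0 ω).IsInitial root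
  step : ∀ t ω, (state t ω).Step G (victim t ω) (state (t + 1) ω)
  adapted_state : ∀ t s, MeasurableSet[ℱ t] {ω | state t ω = s}
  adapted_victim : ∀ t f, MeasurableSet[ℱ (t + 1)] {ω | victim t ω = f}
  uniform_victim : ∀ t A, MeasurableSet[ℱ t] A → ∀ f : Fin m → Fin m, (∀ i, f i ≠ i) →
    μ (A ∩ {ω | victim t ω = f}) = μ A / ((m : ENNReal) - 1) ^ m

/-- The makespan of an execution: the number of slots until all tasks are executed. -/
noncomputable def makespan {Ω V : Type*} {m : ℕ} (state : ℕ → Ω → State m V) (ω : Ω) : ℕ :=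
  sInf {t | (state t ω).executed = Set.univ}

end ABP

/-! In every slot each of the m processors either executes a task or sends one steal request, so
m·C_max = W + R, where R counts the requests up to completion (`Good.requests_next`,
`requests_config_card`). It remains to bound R/m.

A ready task has weight D minus its depth in the enabling tree. Pushing at the bottom and stealing
at the top keep the weights strictly increasing from the second task of a deque to its top
(`StepWith.layered`), so the top task outweighs in potential all the other waiting tasks together.
For weight n ≥ 1 the potential is 4·7^(n-1) at the bottom of a deque and 10·7^(n-1) above it. The
executed task is then replaced by at most two tasks with half of its potential in total, and a
stolen task passes from waiting to running: an active processor never gains potential, and loses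
half of it when requested (`two_mul_dequePotential_le`).

With r thieves, an active processor is missed with probability (1 - 1/(m-1))^r. By concavity the
expected total potential Φ is multiplied by at most κ^(r/m), where κ = (1 + 1/e)/2
(`half_one_add_pow_le`, `State.sum_draws_potential_le`), so κ^(-R/m)·Φ is a supermartingale until
completion. It starts below 8^D, and Φ ≥ 1 while a task is unexecuted. This gives the tail of R
(`measure_requests_le`); a logarithmic version gives its mean (`lintegral_requests_le`). The gap
between 7 and 8 absorbs the additive loss in the mean for D ≥ 4; smaller D follow from C_max ≤ W <
2^(D+1). -/

namespace ABP

/-! ### Potentials of tasks and deques -/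

/-- Potential of a task of weight `n` at the bottom of a deque. -/
def runPotential : ℕ → ℕ
  | 0 => 1
  | n + 1 => 4 * 7 ^ n

/-- Potential of a task of weight `n` that waits in a deque above another task. -/
def waitPotential : ℕ → ℕ
  | 0 => 1
  | n + 1 => 10 * 7 ^ n

lemma runPotential_pos (n : ℕ) : 0 < runPotential n := by
  cases n <;> simp [runPotential]

lemma runPotential_le_waitPotential (n : ℕ) : runPotential n ≤ waitPotential n := by
  cases n <;> simp [runPotential, waitPotential]

/-- The base 7 comes from here: 4 + 10 = 4·7/2, with equality at every weight. -/
lemma waitPotential_add_runPotential_le (n : ℕ) :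
    runPotential n + waitPotential n ≤ runPotential (n + 1) / 2 := by
  cases n with
  | zero => simp [runPotential, waitPotential]
  | succ n =>
    simp only [runPotential, waitPotential, pow_succ]
    omega

/-- The 3 of the final constant is log₂ 8. The true base is 7; the slack serves in
`log_runPotential_add_one_le`. -/
lemma runPotential_le_eight_pow (n : ℕ) : runPotential n ≤ 8 ^ n := by
  cases n with
  | zero => simp [runPotential]
  | succ n =>
    have : 7 ^ n ≤ 8 ^ n := Nat.pow_le_pow_left (by norm_num) n
    simp only [runPotential, pow_succ]
    omega

lemma three_mul_sum_waitPotential (n : ℕ) :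
    3 * ∑ k ∈ Finset.range (n + 1), waitPotential k + 2 = 5 * 7 ^ n := by
  induction n with
  | zero => simp [waitPotential]
  | succ n ih =>
    rw [Finset.sum_range_succ, mul_add, waitPotential, pow_succ]
    omega

lemma sum_map_waitPotential_le {l : List ℕ} (hl : l.Nodup) {n : ℕ} (hn : ∀ k ∈ l, k < n) :
    (l.map waitPotential).sum ≤ ∑ k ∈ Finset.range n, waitPotential k := by
  rw [← List.sum_toFinset _ hl]
  exact Finset.sum_le_sum_of_subset fun k hk => by simpa using hn k (by simpa using hk)

/-- Potential of a deque whose tasks have weights `w`. -/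
def dequePotential {V : Type*} (w : V → ℕ) : List V → ℕ
  | [] => 0
  | u :: rest => runPotential (w u) + (rest.map fun v => waitPotential (w v)).sum

lemma dequePotential_nil {V : Type*} (w : V → ℕ) : dequePotential w [] = 0 := rfl

lemma dequePotential_cons {V : Type*} (w : V → ℕ) (u : V) (rest : List V) :
    dequePotential w (u :: rest) =
      runPotential (w u) + (rest.map fun v => waitPotential (w v)).sum := rfl

lemma dequePotential_le_sum {V : Type*} (w : V → ℕ) (l : List V) :
    dequePotential w l ≤ (l.map fun v => waitPotential (w v)).sum := by
  cases l with
  | nil => simp [dequePotential]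
  | cons u rest => simpa [dequePotential] using runPotential_le_waitPotential (w u)

/-- Executing the bottom task and pushing at most two tasks of smaller weight. -/
lemma dequePotential_append_le {V : Type*} {w : V → ℕ} {n : ℕ} {c rest : List V}
    (hc : c.length ≤ 2) (hw : ∀ x ∈ c, w x + 1 = n) :
    dequePotential w (c ++ rest) ≤
      runPotential n / 2 + (rest.map fun v => waitPotential (w v)).sum := by
  match c, hc with
  | [], _ => exact (dequePotential_le_sum w rest).trans (Nat.le_add_left _ _)
  | [x], _ =>
    obtain rfl := hw x (by simp)
    have := waitPotential_add_runPotential_le (w x)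
    simp only [List.cons_append, List.nil_append, dequePotential]
    omega
  | [x, y], _ =>
    obtain rfl := hw x (by simp)
    have hy : w y = w x := by simpa using hw y (by simp)
    have := waitPotential_add_runPotential_le (w x)
    simp only [List.cons_append, List.nil_append, dequePotential, List.map_cons, List.sum_cons, hy]
    omega

/-- Losing the top task to a thief, who will run it, while the bottom task is executed. -/
lemma steal_potential_le {V : Type*} {w : V → ℕ} {u t : V} {q : List V}
    (hq : (q ++ [t]).Pairwise fun a b => w a < w b) (hu : w u ≤ w t) :
    2 * (runPotential (w u) / 2 + (q.map fun v => waitPotential (w v)).sum + runPotential (w t)) ≤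
      runPotential (w u) + ((q ++ [t]).map fun v => waitPotential (w v)).sum := by
  rw [List.pairwise_append] at hq
  obtain ⟨hq, -, hqt⟩ := hq
  replace hqt : ∀ a ∈ q, w a < w t := fun a ha => hqt a ha t (by simp)
  simp only [List.map_append, List.map_cons, List.map_nil, List.sum_append, List.sum_cons,
    List.sum_nil, add_zero]
  rcases ht : w t with _ | n
  -- At weight 0 running and waiting potentials coincide; the gain comes from the floor `1 / 2 = 0`,
  -- which is why `w u = 0` is needed.
  · have hq0 : q = [] := List.eq_nil_iff_forall_not_mem.2 fun a ha => by
      have := hqt a ha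
      omega
    have hu0 : w u = 0 := by omega
    simp [hq0, hu0, runPotential, waitPotential]
  · have hnd : (q.map w).Nodup :=
      (List.pairwise_map.2 hq).imp fun h => h.ne
    -- Distinct weights at most `n` contribute at most (5/3)·7^n, and 5/3 + 2·4 ≤ 10.
    have hsum := sum_map_waitPotential_le hnd (n := n + 1) (by
      intro k hk
      obtain ⟨a, ha, rfl⟩ := List.mem_map.1 hk
      have := hqt a ha
      omega)
    have h3 := three_mul_sum_waitPotential n
    simp only [List.map_map, Function.comp_def] at hsum
    have hr : runPotential (n + 1) = 4 * 7 ^ n := rfl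
    have hwt : waitPotential (n + 1) = 10 * 7 ^ n := rfl
    omega

/-! ### The deques hold exactly the ready tasks -/

namespace State

variable {m : ℕ} {V : Type*} {G : Digraph V} {s s' : State m V} {f : Fin m → Fin m}

/-- The deques hold each ready task exactly once and nothing else. -/
structure Valid (G : Digraph V) (s : State m V) : Prop where
  mem_iff : ∀ v, (∃ i, v ∈ s.deque i) ↔ v ∉ s.executed ∧ ∀ u, G.Adj u v → u ∈ s.executed
  nodup : ∀ i, (s.deque i).Nodup
  eq_of_mem : ∀ i j v, v ∈ s.deque i → v ∈ s.deque j → i = j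
  executed_closed : ∀ u v, G.Adj u v → v ∈ s.executed → u ∈ s.executed

lemma Executes.mem {i : Fin m} {u : V} (h : s.Executes i u) : u ∈ s.deque i := by
  obtain ⟨rest, h⟩ := h
  simp [h]

lemma Executes.eq {i : Fin m} {u v : V} (h : s.Executes i u) (h' : s.Executes i v) : u = v := by
  obtain ⟨rest, h⟩ := h
  obtain ⟨rest', h'⟩ := h'
  rw [h] at h'
  exact (List.cons.inj h').1

lemma Valid.not_mem_executed (hs : s.Valid G) {i : Fin m} {v : V} (h : v ∈ s.deque i) :
    v ∉ s.executed := ((hs.mem_iff v).1 ⟨i, h⟩).1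

lemma Valid.pred_executed (hs : s.Valid G) {i : Fin m} {u v : V} (h : v ∈ s.deque i)
    (huv : G.Adj u v) : u ∈ s.executed := ((hs.mem_iff v).1 ⟨i, h⟩).2 u huv

lemma Valid.not_mem_deque_of_adj (hs : s.Valid G) {i j : Fin m} {u v : V} (h : s.Executes i u)
    (huv : G.Adj u v) : v ∉ s.deque j := fun hv =>
  hs.not_mem_executed h.mem (hs.pred_executed hv huv)

lemma Valid.not_executedAfter_of_adj (hs : s.Valid G) {i : Fin m} {u v : V} (h : s.Executes i u)
    (huv : G.Adj u v) : v ∉ s.executedAfter := by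
  rintro (hv | ⟨j, hv⟩)
  · exact hs.not_mem_executed h.mem (hs.executed_closed u v huv hv)
  · exact hs.not_mem_deque_of_adj h huv hv.mem

lemma Valid.not_executedAfter_of_mem_rest (hs : s.Valid G) {i : Fin m} {u v : V} {rest : List V}
    (h : s.deque i = u :: rest) (hv : v ∈ rest) : v ∉ s.executedAfter := by
  have hvi : v ∈ s.deque i := by simp [h, hv]
  rintro (hv' | ⟨j, hv'⟩)
  · exact hs.not_mem_executed hvi hv'
  · obtain rfl := hs.eq_of_mem _ _ _ hv'.mem hvi
    obtain rfl := hv'.eq ⟨rest, h⟩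
    have := hs.nodup j
    rw [h] at this
    exact (List.nodup_cons.1 this).1 hv

lemma isValid_of_isInitial {root : V} (source : ∀ v, (∀ u, ¬ G.Adj u v) ↔ v = root)
    (h : s.IsInitial root) : s.Valid G := by
  obtain ⟨he, p, hp, hne⟩ := h
  have key : ∀ i v, v ∈ s.deque i → i = p ∧ v = root := by
    intro i v hv
    by_cases hip : i = p
    · subst hip
      exact ⟨rfl, by simpa [hp] using hv⟩
    · simp [hne i hip] at hv
  refine ⟨fun v => ?_, fun i => ?_, fun i j v hi hj => ?_, fun u v _ hv => ?_⟩
  · simp only [he, Set.mem_empty_iff_false, not_false_eq_true, true_and]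
    rw [source]
    exact ⟨fun ⟨i, hi⟩ => (key i v hi).2, fun h => ⟨p, by simp [hp, h]⟩⟩
  · by_cases hip : i = p
    · simp [hip, hp]
    · simp [hne i hip]
  · rw [(key i v hi).1, (key j v hj).1]
  · simp [he] at hv

/-- The choices of a slot: `c` lists the enabled tasks and `winner` the served thieves. -/
structure StepWith (G : Digraph V) (s : State m V) (f : Fin m → Fin m) (s' : State m V)
    (c : Fin m → List V) (winner : Fin m → Fin m) : Prop where
  executed_eq : s'.executed = s.executedAfter
  enabling : s.IsEnabling G c
  arbitration : s.IsArbitration f winner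
  active : ∀ i u rest, s.deque i = u :: rest →
      ((∃ j, s.Requests f j i) → s'.deque i = c i ++ rest.dropLast) ∧
      ((¬ ∃ j, s.Requests f j i) → s'.deque i = c i ++ rest)
  idle : ∀ j, s.deque j = [] →
      (winner (f j) = j → s'.deque j = (s.deque (f j)).tail.getLast?.toList) ∧
      (winner (f j) ≠ j → s'.deque j = [])

lemma Step.exists_stepWith (h : s.Step G f s') : ∃ c winner, StepWith G s f s' c winner := by
  obtain ⟨h1, c, winner, h2, h3, h4, h5⟩ := h
  exact ⟨c, winner, h1, h2, h3, h4, h5⟩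

namespace StepWith

variable {c : Fin m → List V} {winner : Fin m → Fin m}

lemma mem_deque_of_mem_enabled (h : StepWith G s f s' c winner) {i : Fin m} {v : V}
    (hv : v ∈ c i) : v ∈ s'.deque i := by
  obtain ⟨-, u, ⟨rest, hu⟩, -⟩ := h.enabling.2.1 i v hv
  by_cases hr : ∃ j, s.Requests f j i
  · simp [(h.active i u rest hu).1 hr, hv]
  · simp [(h.active i u rest hu).2 hr, hv]

/-- The three origins are: enabled, kept, stolen. The clause on requests in the second one separates
it from the third. -/
lemma mem_cases (h : StepWith G s f s' c winner) {i : Fin m} {v : V} (hv : v ∈ s'.deque i) :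
    v ∈ c i ∨
    (∃ u rest, s.deque i = u :: rest ∧ v ∈ rest ∧
      ((∃ j, s.Requests f j i) → v ∈ rest.dropLast)) ∨
    (s.deque i = [] ∧ winner (f i) = i ∧
      ∃ u rest, s.deque (f i) = u :: rest ∧ rest.getLast? = some v) := by
  rcases hd : s.deque i with _ | ⟨u, rest⟩
  · by_cases hw : winner (f i) = i
    · rw [(h.idle i hd).1 hw] at hv
      rcases hk : s.deque (f i) with _ | ⟨u, rest⟩
      · simp [hk] at hv
      · exact Or.inr (Or.inr ⟨rfl, hw, u, rest, rfl, by simpa [hk] using hv⟩)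
    · simp [(h.idle i hd).2 hw] at hv
  · by_cases hr : ∃ j, s.Requests f j i
    · rw [(h.active i u rest hd).1 hr] at hv
      rcases List.mem_append.1 hv with hv | hv
      · exact Or.inl hv
      · exact Or.inr (Or.inl ⟨u, rest, rfl, List.mem_of_mem_dropLast hv, fun _ => hv⟩)
    · rw [(h.active i u rest hd).2 hr] at hv
      rcases List.mem_append.1 hv with hv | hv
      · exact Or.inl hv
      · exact Or.inr (Or.inl ⟨u, rest, rfl, hv, fun h => absurd h hr⟩)

lemma enabled_or_mem_rest (h : StepWith G s f s' c winner) {i : Fin m} {v : V}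
    (hv : v ∈ s'.deque i) :
    v ∈ c i ∨ ∃ k u rest, s.deque k = u :: rest ∧ v ∈ rest := by
  rcases h.mem_cases hv with h | ⟨u, rest, h, hv, -⟩ | ⟨-, -, u, rest, h, hv⟩
  · exact Or.inl h
  · exact Or.inr ⟨_, u, rest, h, hv⟩
  · exact Or.inr ⟨_, u, rest, h, List.mem_of_getLast? hv⟩

lemma not_mem_of_mem_enabled (hs : s.Valid G) (h : StepWith G s f s' c winner) {i j : Fin m}
    {v : V} (hv : v ∈ c i) : v ∉ s.deque j := by
  obtain ⟨-, u, hu, huv⟩ := h.enabling.2.1 i v hv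
  exact hs.not_mem_deque_of_adj hu huv

/-- A steal loses no task: arbitration names a genuine requester, whose deque was empty and who
receives the removed top task. -/
lemma exists_mem_deque_of_mem_rest (h : StepWith G s f s' c winner)
    {i : Fin m} {u v : V} {rest : List V} (hi : s.deque i = u :: rest) (hv : v ∈ rest) :
    ∃ j, v ∈ s'.deque j := by
  by_cases hr : ∃ j, s.Requests f j i
  · have hne : rest ≠ [] := List.ne_nil_of_mem hv
    rw [← List.dropLast_append_getLast hne, List.mem_append, List.mem_singleton] at hv
    rcases hv with hv | hv
    · exact ⟨i, by simp [(h.active i u rest hi).1 hr, hv]⟩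
    · obtain ⟨hd, hf⟩ := h.arbitration i hr
      refine ⟨winner i, ?_⟩
      rw [(h.idle _ hd).1 (by rw [hf]), hf, hi]
      simp [List.getLast?_eq_getLast_of_ne_nil hne, hv]
  · exact ⟨i, by simp [(h.active i u rest hi).2 hr, hv]⟩

lemma nodup (hs : s.Valid G) (h : StepWith G s f s' c winner) (i : Fin m) :
    (s'.deque i).Nodup := by
  rcases hd : s.deque i with _ | ⟨u, rest⟩
  · by_cases hw : winner (f i) = i
    · rw [(h.idle i hd).1 hw]
      cases (s.deque (f i)).tail.getLast? <;> simp
    · simp [(h.idle i hd).2 hw]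
  · have hn := hs.nodup i
    rw [hd, List.nodup_cons] at hn
    have hdis : List.Disjoint (c i) rest := fun v hv hv' =>
      not_mem_of_mem_enabled hs h hv (j := i) (by simp [hd, hv'])
    by_cases hr : ∃ j, s.Requests f j i
    · rw [(h.active i u rest hd).1 hr]
      exact (h.enabling.1 i).append (hn.2.sublist (List.dropLast_sublist _))
        fun v hv hv' => hdis hv (List.mem_of_mem_dropLast hv')
    · rw [(h.active i u rest hd).2 hr]
      exact (h.enabling.1 i).append hn.2 hdis

/-- The victim was requested, so it keeps only `rest.dropLast`, which misses the last task because
there are no duplicates. -/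
lemma not_mem_rest_of_stolen (hs : s.Valid G) {i j : Fin m} {v : V}
    (hi : ∃ u rest, s.deque i = u :: rest ∧ v ∈ rest ∧
      ((∃ j, s.Requests f j i) → v ∈ rest.dropLast))
    (hj : s.deque j = [] ∧ winner (f j) = j ∧
      ∃ u rest, s.deque (f j) = u :: rest ∧ rest.getLast? = some v) : False := by
  obtain ⟨u, rest, hd, hv, hr⟩ := hi
  obtain ⟨hj, -, u', rest', hd', hv'⟩ := hj
  obtain rfl : i = f j := hs.eq_of_mem _ _ v (by simp [hd, hv])
    (by simp [hd', List.mem_of_getLast? hv'])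
  rw [hd] at hd'
  obtain ⟨rfl, rfl⟩ := List.cons.inj hd'
  have hmem := hr ⟨j, hj, rfl⟩
  have hn := hs.nodup (f j)
  rw [hd, List.nodup_cons, ← List.dropLast_append_getLast? v hv'] at hn
  exact List.disjoint_of_nodup_append hn.2 hmem (by simp)

lemma valid (hs : s.Valid G) (h : StepWith G s f s' c winner) : s'.Valid G := by
  refine ⟨fun v => ⟨fun ⟨i, hv⟩ => ?_, fun ⟨hv, hp⟩ => ?_⟩, h.nodup hs,
    fun i j v hi hj => ?_, fun u v huv hv => ?_⟩
  · rw [h.executed_eq]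
    rcases h.enabled_or_mem_rest hv with hv | ⟨k, u, rest, hk, hv⟩
    · obtain ⟨hb, u, hu, huv⟩ := h.enabling.2.1 i v hv
      exact ⟨hs.not_executedAfter_of_adj hu huv, hb.2⟩
    · exact ⟨hs.not_executedAfter_of_mem_rest hk hv, fun w hw =>
        Or.inl (hs.pred_executed (i := k) (by simp [hk, hv]) hw)⟩
  · rw [h.executed_eq] at hv hp
    by_cases hnew : ∃ i u, s.Executes i u ∧ G.Adj u v
    · obtain ⟨i, hi, -⟩ := h.enabling.2.2 v ⟨hnew, hp⟩
      exact ⟨i, h.mem_deque_of_mem_enabled hi⟩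
    · obtain ⟨i, hi⟩ := (hs.mem_iff v).2 ⟨fun hv' => hv (Or.inl hv'), fun u hu =>
        (hp u hu).resolve_right fun ⟨i, hi⟩ => hnew ⟨i, u, hi, hu⟩⟩
      rcases hd : s.deque i with _ | ⟨u, rest⟩
      · simp [hd] at hi
      · rw [hd, List.mem_cons] at hi
        rcases hi with rfl | hi
        · exact absurd (Or.inr ⟨i, rest, hd⟩) hv
        · exact h.exists_mem_deque_of_mem_rest hd hi
  · rcases h.mem_cases hi with hi | hi | hi
    · have hnot := fun k => not_mem_of_mem_enabled hs h hi (j := k)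
      rcases h.mem_cases hj with hj | ⟨u, rest, hd, hj, -⟩ | ⟨-, -, u, rest, hd, hj⟩
      · exact (h.enabling.2.2 v (h.enabling.2.1 i v hi).1).unique hi hj
      · exact absurd (by simp [hd, hj]) (hnot j)
      · exact absurd (by simp [hd, List.mem_of_getLast? hj]) (hnot (f j))
    · rcases h.mem_cases hj with hj | hj | hj
      · obtain ⟨u, rest, hd, hi, -⟩ := hi
        exact absurd (by simp [hd, hi]) (not_mem_of_mem_enabled hs h hj (j := i))
      · obtain ⟨u, rest, hd, hi, -⟩ := hi
        obtain ⟨u', rest', hd', hj, -⟩ := hj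
        exact hs.eq_of_mem i j v (by simp [hd, hi]) (by simp [hd', hj])
      · exact (not_mem_rest_of_stolen hs hi hj).elim
    · rcases h.mem_cases hj with hj | hj | hj
      · obtain ⟨-, -, u, rest, hd, hi⟩ := hi
        exact absurd (by simp [hd, List.mem_of_getLast? hi])
          (not_mem_of_mem_enabled hs h hj (j := f i))
      · exact (not_mem_rest_of_stolen hs hj hi).elim
      · obtain ⟨-, hwi, u, rest, hd, hi⟩ := hi
        obtain ⟨-, hwj, u', rest', hd', hj⟩ := hj
        -- Two holders of the same stolen task have the same victim, so both are its winner.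
        rw [← hwi, ← hwj, hs.eq_of_mem (f i) (f j) v (by simp [hd, List.mem_of_getLast? hi])
          (by simp [hd', List.mem_of_getLast? hj])]
  · rw [h.executed_eq] at hv ⊢
    rcases hv with hv | ⟨i, hi⟩
    · exact Or.inl (hs.executed_closed u v huv hv)
    · exact Or.inl (hs.pred_executed hi.mem huv)

end StepWith

/-! ### Counting active processors and thieves -/

/-- The number of thieves in a slot. -/
noncomputable def thieves (s : State m V) : ℕ := {i | s.deque i = []}.ncard

/-- Every slot executes one task for each processor that is not a thief. -/
lemma Valid.ncard_executedAfter [Finite V] (hs : s.Valid G) :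
    s.executedAfter.ncard + s.thieves = s.executed.ncard + m := by
  classical
  have hex : ∀ i : {i // s.deque i ≠ []}, ∃ u, s.Executes i u := fun ⟨i, hi⟩ => by
    obtain ⟨u, rest, h⟩ := List.exists_cons_of_ne_nil hi
    exact ⟨u, rest, h⟩
  choose g hg using hex
  have hinj : Function.Injective g := fun i j hij => Subtype.ext <|
    hs.eq_of_mem _ _ _ (hg i).mem (hij ▸ (hg j).mem)
  have hset : {u | ∃ i, s.Executes i u} = Set.range g := by
    ext u
    constructor
    · rintro ⟨i, rest, hi⟩
      have hne : s.deque i ≠ [] := by simp [hi]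
      exact ⟨⟨i, hne⟩, (hg ⟨i, hne⟩).eq ⟨rest, hi⟩⟩
    · rintro ⟨i, rfl⟩
      exact ⟨i, hg i⟩
  have hdis : Disjoint s.executed {u | ∃ i, s.Executes i u} :=
    Set.disjoint_left.2 fun u hu ⟨i, hi⟩ => hs.not_mem_executed hi.mem hu
  have hcard : {u | ∃ i, s.Executes i u}.ncard = {i | s.deque i ≠ []}.ncard := by
    rw [hset, ← Set.image_univ, Set.ncard_image_of_injective _ hinj, Set.ncard_univ]
    rfl
  have hcompl := Set.ncard_add_ncard_compl {i | s.deque i = []}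
  rw [Nat.card_fin] at hcompl
  have hne : {i | s.deque i ≠ []}.ncard = {i | s.deque i = []}ᶜ.ncard := rfl
  rw [executedAfter, Set.ncard_union_eq hdis, hcard, thieves]
  omega

/-- As long as a task is unexecuted, some processor is active. -/
lemma Valid.exists_deque_ne_nil [Finite V] (acyclic : ∀ v, ¬ Relation.TransGen G.Adj v v)
    (hs : s.Valid G) (h : s.executed ≠ Set.univ) : ∃ i, s.deque i ≠ [] := by
  have : IsTrans V (Relation.TransGen G.Adj) := ⟨fun _ _ _ => Relation.TransGen.trans⟩
  have : Std.Irrefl (Relation.TransGen G.Adj) := ⟨acyclic⟩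
  have wf : WellFounded (Relation.TransGen G.Adj) := Finite.wellFounded_of_trans_of_irrefl _
  -- A minimal unexecuted task is ready, hence lies in a deque.
  obtain ⟨v, hv, hmin⟩ := wf.has_min s.executedᶜ (Set.nonempty_compl.2 h)
  obtain ⟨i, hi⟩ := (hs.mem_iff v).2 ⟨hv, fun u hu => by
    by_contra hne
    exact hmin u hne (.single hu)⟩
  exact ⟨i, List.ne_nil_of_mem hi⟩

lemma thieves_lt {i : Fin m} (h : s.deque i ≠ []) : s.thieves < m := by
  have : s.thieves < (Set.univ : Set (Fin m)).ncard :=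
    Set.ncard_lt_ncard (Set.ssubset_univ_iff.2 fun he => h (by
      have : i ∈ {i | s.deque i = []} := he ▸ Set.mem_univ i
      exact this))
  simpa [Set.ncard_univ] using this

end State

/-! ### Depths in the enabling tree -/

namespace State

variable {m : ℕ} {V : Type*} {G : Digraph V} {s s' : State m V} {f : Fin m → Fin m} {d : V → ℕ}

open Classical in
/-- Depth of the tasks in the enabling tree, updated in the slot that leads from `s` to `s'`. -/
noncomputable def nextDepth (s s' : State m V) (d : V → ℕ) (v : V) : ℕ :=
  if h : ∃ u, (∃ i, s.Executes i u ∧ v ∈ s'.deque i) ∧ ∀ j, v ∉ s.deque j then d h.choose + 1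
  else d v

/-- From the second task of a deque to its top, the depths decrease strictly; the depth of a task is
the length of a path that leads to it. -/
structure Layered (G : Digraph V) (s : State m V) (d : V → ℕ) : Prop where
  sorted : ∀ i u rest, s.deque i = u :: rest →
    rest.Pairwise (fun a b => d b < d a) ∧ ∀ v ∈ rest, d v ≤ d u
  path : ∀ i v, v ∈ s.deque i →
    ∃ p : List V, p.IsChain G.Adj ∧ p.length = d v + 1 ∧ p.getLast? = some v

lemma Layered.depth_le {D : ℕ} (critical : IsCriticalPath G D) (h : s.Layered G d) {i : Fin m}
    {v : V} (hv : v ∈ s.deque i) : d v ≤ D := by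
  obtain ⟨p, hp, hl, -⟩ := h.path i v hv
  exact critical.2 ⟨p, hp, hl⟩

lemma layered_of_isInitial {root : V} (h : s.IsInitial root) : s.Layered G fun _ => 0 := by
  obtain ⟨-, p, hp, hne⟩ := h
  refine ⟨fun i u rest hi => ?_, fun i v _ => ⟨[v], by simp⟩⟩
  by_cases hip : i = p
  · subst hip
    rw [hp] at hi
    obtain ⟨-, rfl⟩ := List.cons.inj hi
    simp
  · simp [hne i hip] at hi

namespace StepWith

variable {c : Fin m → List V} {winner : Fin m → Fin m}

/-- The choice inside `nextDepth` is forced, since only one deque holds `v`. Thus depths depend on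
the two states alone and not on `c`. -/
lemma nextDepth_of_mem_enabled (hs : s.Valid G) (h : StepWith G s f s' c winner) {i : Fin m}
    {u v : V} (hv : v ∈ c i) (hu : s.Executes i u) : s.nextDepth s' d v = d u + 1 := by
  have hex : ∃ u, (∃ i, s.Executes i u ∧ v ∈ s'.deque i) ∧ ∀ j, v ∉ s.deque j :=
    ⟨u, ⟨i, hu, h.mem_deque_of_mem_enabled hv⟩, fun j => not_mem_of_mem_enabled hs h hv⟩
  obtain ⟨⟨j, hj, hvj⟩, -⟩ := hex.choose_spec
  obtain rfl := (h.valid hs).eq_of_mem _ _ _ hvj (h.mem_deque_of_mem_enabled hv)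
  rw [nextDepth, dif_pos hex, hj.eq hu]

lemma nextDepth_of_mem (s' : State m V) {i : Fin m} {v : V} (hv : v ∈ s.deque i) :
    s.nextDepth s' d v = d v :=
  dif_neg fun ⟨_, _, h⟩ => h i hv

lemma length_enabled_le [Finite V] (outdegree : ∀ v, {w | G.Adj v w}.ncard ≤ 2)
    (h : StepWith G s f s' c winner) {i : Fin m} {u : V} (hu : s.Executes i u) :
    (c i).length ≤ 2 := by
  classical
  rw [← List.toFinset_card_of_nodup (h.enabling.1 i), ← Set.ncard_coe_finset]
  refine (Set.ncard_le_ncard (fun v hv => ?_) (Set.toFinite _)).trans (outdegree u)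
  obtain ⟨-, u', hu', huv⟩ := h.enabling.2.1 i v (by simpa using hv)
  rwa [hu'.eq hu] at huv

lemma exists_deque_eq (h : StepWith G s f s' c winner) {i : Fin m} {u : V} {rest : List V}
    (hd : s.deque i = u :: rest) :
    ∃ rest', rest'.Sublist rest ∧ s'.deque i = c i ++ rest' := by
  by_cases hr : ∃ j, s.Requests f j i
  · exact ⟨_, List.dropLast_sublist _, (h.active i u rest hd).1 hr⟩
  · exact ⟨_, List.Sublist.refl _, (h.active i u rest hd).2 hr⟩

/-- Enabled tasks get depth `d u + 1`, above everything kept from `rest`. Two of them tie, but one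
is then at the bottom, so strictness survives from the second entry on. A thief ends with at most
one task. -/
lemma layered [Finite V] (outdegree : ∀ v, {w | G.Adj v w}.ncard ≤ 2)
    (hs : s.Valid G) (hl : s.Layered G d) (h : StepWith G s f s' c winner) :
    s'.Layered G (s.nextDepth s' d) := by
  refine ⟨fun i x l hi => ?_, fun i v hv => ?_⟩
  · rcases hd : s.deque i with _ | ⟨u, rest⟩
    · have : l = [] := by
        by_cases hw : winner (f i) = i
        · rw [(h.idle i hd).1 hw] at hi
          cases ht : (s.deque (f i)).tail.getLast? <;> simp_all
        · simp [(h.idle i hd).2 hw] at hi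
      simp [this]
    · obtain ⟨rest', hsub, hd'⟩ := h.exists_deque_eq hd
      have hlen := h.length_enabled_le outdegree ⟨rest, hd⟩
      have hc : ∀ v ∈ c i, s.nextDepth s' d v = d u + 1 := fun v hv =>
        h.nextDepth_of_mem_enabled hs hv ⟨rest, hd⟩
      have hr : ∀ v ∈ rest', s.nextDepth s' d v = d v := fun v hv =>
        nextDepth_of_mem s' (i := i) (by simp [hd, hsub.subset hv])
      have hru : ∀ v ∈ rest', s.nextDepth s' d v ≤ d u := fun v hv => by
        rw [hr v hv]
        exact (hl.sorted i u rest hd).2 v (hsub.subset hv)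
      have hpw : rest'.Pairwise (fun a b => s.nextDepth s' d b < s.nextDepth s' d a) := by
        refine ((hl.sorted i u rest hd).1.sublist hsub).imp_of_mem fun ha hb hab => ?_
        rwa [hr _ ha, hr _ hb]
      rw [hd'] at hi
      generalize s.nextDepth s' d = d' at hc hr hru hpw ⊢
      generalize c i = l' at hc hi hlen
      match l', hlen with
      | [], _ =>
        rw [List.nil_append] at hi
        rw [hi, List.pairwise_cons] at hpw
        exact ⟨hpw.2, fun v hv => (hpw.1 v hv).le⟩
      | [y], _ =>
        obtain ⟨rfl, rfl⟩ := List.cons.inj hi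
        exact ⟨hpw, fun v hv => by
          have := hru v hv
          have := hc y (by simp)
          omega⟩
      | [y, z], _ =>
        obtain ⟨rfl, rfl⟩ := List.cons.inj hi
        have hy := hc y (by simp)
        have hz := hc z (by simp)
        refine ⟨List.pairwise_cons.2 ⟨fun v hv => ?_, hpw⟩, fun v hv => ?_⟩
        · have := hru v hv
          omega
        · rcases List.mem_cons.1 hv with rfl | hv
          · omega
          · have := hru v hv
            omega
  · rcases h.enabled_or_mem_rest hv with hv | ⟨k, u, rest, hk, hv⟩
    · obtain ⟨-, u, hu, huv⟩ := h.enabling.2.1 i v hv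
      obtain ⟨p, hp, hlen, hlast⟩ := hl.path i u hu.mem
      refine ⟨p ++ [v], ?_, ?_, by simp⟩
      · rw [List.isChain_append]
        refine ⟨hp, by simp, fun x hx y hy => ?_⟩
        rw [hlast] at hx
        simp only [Option.mem_def, Option.some.injEq, List.head?_cons] at hx hy
        rwa [← hx, ← hy]
      · rw [h.nextDepth_of_mem_enabled hs hv hu]
        simp [hlen]
    · have hvk : v ∈ s.deque k := by simp [hk, hv]
      rw [nextDepth_of_mem s' hvk]
      exact hl.path k v hvk

end StepWith

/-! ### Decrease of the potential in one slot -/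

/-- Potential of a configuration whose tasks have depths `d`. -/
def potential (D : ℕ) (s : State m V) (d : V → ℕ) : ℕ :=
  ∑ i, dequePotential (fun v => D - d v) (s.deque i)

lemma potential_pos {D : ℕ} {i : Fin m} (h : s.deque i ≠ []) : 0 < s.potential D d := by
  refine lt_of_lt_of_le ?_ (Finset.single_le_sum
    (f := fun i => dequePotential (fun v => D - d v) (s.deque i)) (fun _ _ => Nat.zero_le _)
    (Finset.mem_univ i))
  obtain ⟨u, rest, hd⟩ := List.exists_cons_of_ne_nil h
  simp only [hd, dequePotential]
  exact Nat.add_pos_left (runPotential_pos _) _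

lemma potential_of_isInitial {root : V} (D : ℕ) (h : s.IsInitial root) :
    s.potential D (fun _ => 0) = runPotential D := by
  obtain ⟨-, p, hp, hne⟩ := h
  rw [potential, Finset.sum_eq_single p]
  · simp [hp, dequePotential]
  · intro i _ hi
    simp [hne i hi, dequePotential]
  · simp

open Classical in
/-- Potential with which the served thief of processor `k` starts. -/
noncomputable def stolenPotential (w : V → ℕ) (s : State m V) (f : Fin m → Fin m) (k : Fin m) : ℕ :=
  if ∃ j, s.Requests f j k then dequePotential w (s.deque k).tail.getLast?.toList else 0

namespace StepWith

variable {c : Fin m → List V} {winner : Fin m → Fin m} {D : ℕ}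

open Classical in
/-- A slot does not increase the potential of an active processor, and halves it if the processor
receives a steal request. -/
lemma two_mul_dequePotential_le [Finite V] (outdegree : ∀ v, {w | G.Adj v w}.ncard ≤ 2)
    (critical : IsCriticalPath G D)
    (hs : s.Valid G) (hl : s.Layered G d) (h : StepWith G s f s' c winner) {i : Fin m}
    (hi : s.deque i ≠ []) :
    2 * (dequePotential (fun v => D - s.nextDepth s' d v) (s'.deque i) +
        stolenPotential (fun v => D - s.nextDepth s' d v) s f i) ≤
      dequePotential (fun v => D - d v) (s.deque i) *
        (if ∃ j, s.Requests f j i then 1 else 2) := by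
  obtain ⟨u, rest, hd⟩ := List.exists_cons_of_ne_nil hi
  have hl' := h.layered outdegree hs hl
  have hlen := h.length_enabled_le outdegree ⟨rest, hd⟩
  -- Subtraction is truncated: the new depth must be at most `D`, which holds because a path of that
  -- length leads to `v`.
  have hc : ∀ v ∈ c i, D - s.nextDepth s' d v + 1 = D - d u := fun v hv => by
    have h1 := h.nextDepth_of_mem_enabled (d := d) hs hv ⟨rest, hd⟩
    have h2 := hl'.depth_le critical (h.mem_deque_of_mem_enabled hv)
    omega
  have hr : ∀ v ∈ rest, s.nextDepth s' d v = d v := fun v hv =>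
    nextDepth_of_mem s' (i := i) (by simp [hd, hv])
  have hD : ∀ v ∈ rest, d v ≤ D := fun v hv =>
    hl.depth_le critical (i := i) (by simp [hd, hv])
  obtain ⟨hpw, hru⟩ := hl.sorted i u rest hd
  have hsum : ∀ q : List V, (∀ v ∈ q, v ∈ rest) →
      (q.map fun v => waitPotential (D - s.nextDepth s' d v)).sum =
        (q.map fun v => waitPotential (D - d v)).sum := fun q hq => by
    congr 1
    exact List.map_congr_left fun v hv => by rw [hr v (hq v hv)]
  have hrest := dequePotential_append_le (w := fun v => D - s.nextDepth s' d v) (rest := rest)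
    hlen hc
  rw [hsum rest fun _ => id] at hrest
  by_cases hreq : ∃ j, s.Requests f j i
  · rw [(h.active i u rest hd).1 hreq, stolenPotential, if_pos hreq, if_pos hreq, mul_one]
    -- With nothing to steal, the execution alone halves the potential; otherwise the stolen task
    -- `t` is charged to its victim.
    rcases List.eq_nil_or_concat rest with rfl | ⟨q, t, rfl⟩
    · simp only [List.map_nil, List.sum_nil] at hrest
      simp only [hd, List.dropLast_nil, List.tail_cons, List.getLast?_nil, Option.toList_none,
        dequePotential_cons, dequePotential_nil, List.map_nil, List.sum_nil]
      omega
    · rw [List.concat_eq_append] at hd hr hD hpw hru hsum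
      have hq := dequePotential_append_le (w := fun v => D - s.nextDepth s' d v) (rest := q)
        hlen hc
      rw [hsum q fun v hv => by simp [hv]] at hq
      have hst := steal_potential_le (w := fun v => D - d v) (u := u) (t := t) (q := q)
        (hpw.imp_of_mem fun {a b} ha hb hab => by
          have := hD a ha
          have := hD b hb
          omega)
        (by
          have := hru t (by simp)
          omega)
      have ht := hr t (by simp)
      rw [List.concat_eq_append, List.dropLast_concat]
      simp only [hd, List.tail_cons, List.getLast?_concat, Option.toList_some, dequePotential_cons,
        List.map_nil, List.sum_nil, add_zero, ht]
      omega
  · rw [(h.active i u rest hd).2 hreq, stolenPotential, if_neg hreq, if_neg hreq, hd]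
    simp only [dequePotential_cons]
    omega

open Classical in
/-- The potential of a processor is halved if it receives a steal request. -/
lemma two_mul_potential_le [Finite V] (outdegree : ∀ v, {w | G.Adj v w}.ncard ≤ 2)
    (critical : IsCriticalPath G D)
    (hs : s.Valid G) (hl : s.Layered G d) (h : StepWith G s f s' c winner) :
    2 * s'.potential D (s.nextDepth s' d) ≤
      ∑ i, dequePotential (fun v => D - d v) (s.deque i) *
        (if ∃ j, s.Requests f j i then 1 else 2) := by
  set w' : V → ℕ := fun v => D - s.nextDepth s' d v with hw'
  let S : Finset (Fin m) := {i | s.deque i = [] ∧ winner (f i) = i}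
  -- A victim serves one thief, so served thieves are charged to distinct victims.
  have hthief : ∑ i ∈ S, dequePotential w' (s'.deque i) ≤ ∑ k, stolenPotential w' s f k := by
    have hinj : Set.InjOn f S := fun i hi j hj hij => by
      simp only [S, Finset.coe_filter, Finset.mem_univ, true_and, Set.mem_ofPred_eq] at hi hj
      rw [← hi.2, ← hj.2, hij]
    calc ∑ i ∈ S, dequePotential w' (s'.deque i)
        = ∑ i ∈ S, stolenPotential w' s f (f i) := Finset.sum_congr rfl fun i hi => by
          simp only [S, Finset.mem_filter, Finset.mem_univ, true_and] at hi
          rw [(h.idle i hi.1).1 hi.2, stolenPotential, if_pos ⟨i, hi.1, rfl⟩]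
      _ = ∑ k ∈ S.image f, stolenPotential w' s f k := (Finset.sum_image hinj).symm
      _ ≤ _ := Finset.sum_le_sum_of_subset (Finset.subset_univ _)
  have hsplit : ∀ i, dequePotential w' (s'.deque i) =
      (if s.deque i ≠ [] then dequePotential w' (s'.deque i) else 0) +
        (if i ∈ S then dequePotential w' (s'.deque i) else 0) := fun i => by
    by_cases hi : s.deque i = []
    · by_cases hwi : winner (f i) = i
      · simp [S, hi, hwi]
      · simp [S, hi, hwi, (h.idle i hi).2 hwi, dequePotential]
    · simp [S, hi]
  have hpot : s'.potential D (s.nextDepth s' d) ≤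
      ∑ i, ((if s.deque i ≠ [] then dequePotential w' (s'.deque i) else 0) +
        stolenPotential w' s f i) := by
    rw [potential, ← hw', Finset.sum_congr rfl fun i _ => hsplit i, Finset.sum_add_distrib,
      Finset.sum_add_distrib, Finset.sum_ite_mem, Finset.univ_inter]
    exact Nat.add_le_add_left hthief _
  refine (Nat.mul_le_mul_left 2 hpot).trans ?_
  rw [Finset.mul_sum]
  refine Finset.sum_le_sum fun i _ => ?_
  by_cases hi : s.deque i = []
  · simp [hi, stolenPotential, dequePotential]
  · rw [if_pos hi]
    exact h.two_mul_dequePotential_le outdegree critical hs hl hi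

end StepWith

end State

/-! ### Uniform draws of the victims -/

/-- The expected factor by which the potential decreases if every processor is hit by a request with
probability `1 - 1 / e`. -/
noncomputable def stealFactor : ℝ := (1 + Real.exp (-1)) / 2

lemma stealFactor_pos : 0 < stealFactor := by
  unfold stealFactor
  positivity

lemma stealFactor_lt_one : stealFactor < 1 := by
  have : Real.exp (-1) < 1 := by simp
  unfold stealFactor
  linarith

/-- With θ = r/n ≤ 1, (1 - 1/n)^r ≤ e^(-θ), and concavity of x ↦ x^θ between 1 and e⁻¹ gives the
rest. -/
lemma half_one_add_pow_le {n r : ℕ} (hn : 1 ≤ n) (hr : r ≤ n) :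
    (1 + (1 - 1 / (n : ℝ)) ^ r) / 2 ≤ stealFactor ^ ((r : ℝ) / n) := by
  have hn' : (0 : ℝ) < n := by exact_mod_cast hn
  have hθ0 : (0 : ℝ) ≤ (r : ℝ) / n := by positivity
  have hθ1 : (r : ℝ) / n ≤ 1 := (div_le_one hn').2 (by exact_mod_cast hr)
  have h1 : (1 - 1 / (n : ℝ)) ^ r ≤ Real.exp (-1) ^ ((r : ℝ) / n) := by
    have h0 : 0 ≤ 1 - 1 / (n : ℝ) := by
      rw [sub_nonneg, div_le_one hn']
      exact_mod_cast hn
    have hexp : 1 - 1 / (n : ℝ) ≤ Real.exp (-(1 / n)) := by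
      linarith [Real.add_one_le_exp (-(1 / (n : ℝ)))]
    calc (1 - 1 / (n : ℝ)) ^ r ≤ Real.exp (-(1 / n)) ^ r := pow_le_pow_left₀ h0 hexp r
      _ = Real.exp (-1) ^ ((r : ℝ) / n) := by
        rw [← Real.exp_nat_mul, ← Real.exp_mul]
        congr 1
        ring
  have h2 := (Real.concaveOn_rpow hθ0 hθ1).2 (show (1 : ℝ) ∈ Set.Ici 0 by simp)
    (show Real.exp (-1) ∈ Set.Ici 0 from (Real.exp_pos _).le)
    (show (0 : ℝ) ≤ 1 / 2 by norm_num) (show (0 : ℝ) ≤ 1 / 2 by norm_num) (by norm_num)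
  simp only [smul_eq_mul, Real.one_rpow] at h2
  calc (1 + (1 - 1 / (n : ℝ)) ^ r) / 2
      ≤ 1 / 2 * 1 + 1 / 2 * Real.exp (-1) ^ ((r : ℝ) / n) := by linarith
    _ ≤ _ := h2
    _ = stealFactor ^ ((r : ℝ) / n) := by
      unfold stealFactor
      congr 1
      ring

namespace State

variable {m : ℕ} {V : Type*} {s : State m V}

/-- The draws in which no processor chooses itself. -/
def draws (m : ℕ) : Finset (Fin m → Fin m) := Fintype.piFinset fun i => {i}ᶜ

lemma mem_draws {f : Fin m → Fin m} : f ∈ draws m ↔ ∀ i, f i ≠ i := by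
  simp [draws, Fintype.mem_piFinset]

lemma card_draws : (draws m).card = (m - 1) ^ m := by
  simp [draws, Fintype.card_piFinset, Finset.card_compl]

open Classical in
-- A thief avoids itself and `i`, which differ as `i` is active; every other processor avoids only
-- itself.
lemma card_draws_not_requested {i : Fin m} (hi : s.deque i ≠ []) :
    {f ∈ draws m | ¬ ∃ j, s.Requests f j i}.card =
      (m - 2) ^ s.thieves * (m - 1) ^ (m - s.thieves) := by
  have hset : {f ∈ draws m | ¬ ∃ j, s.Requests f j i} =
      Fintype.piFinset fun j => if s.deque j = [] then ({j, i} : Finset (Fin m))ᶜ else {j}ᶜ := by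
    ext f
    simp only [Finset.mem_filter, mem_draws, Fintype.mem_piFinset, Requests, not_exists, not_and]
    rw [← forall_and]
    refine forall_congr' fun j => ?_
    by_cases hj : s.deque j = [] <;> simp [hj]
  have hthieves : s.thieves = (Finset.univ.filter fun j => s.deque j = []).card := by
    rw [thieves, ← Set.ncard_coe_finset]
    simp
  have hcompl : m - s.thieves = (Finset.univ.filter fun j => ¬ s.deque j = []).card := by
    have := Finset.card_filter_add_card_filter_not (s := Finset.univ)
      (fun j : Fin m => s.deque j = [])
    rw [Finset.card_univ, Fintype.card_fin] at this
    omega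
  rw [hset, Fintype.card_piFinset, hcompl, hthieves, ← Finset.prod_const, ← Finset.prod_const,
    ← Finset.prod_ite]
  refine Finset.prod_congr rfl fun j _ => ?_
  by_cases hj : s.deque j = []
  · have hne : j ≠ i := fun h => hi (h ▸ hj)
    rw [if_pos hj, if_pos hj, Finset.card_compl, Finset.card_pair hne, Fintype.card_fin]
  · rw [if_neg hj, if_neg hj, Finset.card_compl, Finset.card_singleton, Fintype.card_fin]

open Classical in
lemma sum_draws_le (hm : 2 ≤ m) {i : Fin m} (hi : s.deque i ≠ []) :
    ∑ f ∈ draws m, (if ∃ j, s.Requests f j i then 1 else 2 : ℝ) ≤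
      2 * ((m : ℝ) - 1) ^ m * stealFactor ^ ((s.thieves : ℝ) / m) := by
  obtain ⟨n, rfl⟩ : ∃ n, m = n + 1 := ⟨m - 1, by omega⟩
  have hn : 1 ≤ n := by omega
  have hr : s.thieves ≤ n := Nat.lt_succ_iff.1 (thieves_lt hi)
  have hn' : (0 : ℝ) < n := by exact_mod_cast hn
  have hsum : ∑ f ∈ draws (n + 1), (if ∃ j, s.Requests f j i then 1 else 2 : ℝ) =
      ((draws (n + 1)).card : ℝ) + ({f ∈ draws (n + 1) | ¬ ∃ j, s.Requests f j i}.card : ℝ) := by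
    rw [Finset.card_filter, Finset.card_eq_sum_ones]
    push_cast
    rw [← Finset.sum_add_distrib]
    refine Finset.sum_congr rfl fun f _ => ?_
    by_cases h : ∃ j, s.Requests f j i
    · rw [if_pos h, if_neg (not_not.2 h), add_zero]
    · rw [if_neg h, if_pos h]
      norm_num
  have hpow : ((n + 1 - 2 : ℕ) : ℝ) ^ s.thieves * (n : ℝ) ^ (n + 1 - s.thieves) =
      (n : ℝ) ^ (n + 1) * (1 - 1 / (n : ℝ)) ^ s.thieves := by
    have h1 : ((n + 1 - 2 : ℕ) : ℝ) = n * (1 - 1 / n) := by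
      rw [mul_sub, mul_one, mul_one_div_cancel hn'.ne', show n + 1 - 2 = n - 1 by omega]
      push_cast [hn]
      ring
    have h2 : (n : ℝ) ^ (n + 1) = (n : ℝ) ^ s.thieves * (n : ℝ) ^ (n + 1 - s.thieves) := by
      rw [← pow_add]
      congr 1
      omega
    rw [h1, h2, mul_pow]
    ring
  -- The exponent is relaxed from r/(m-1) to r/m because one request accounts for 1/m of a slot.
  have hexp : stealFactor ^ ((s.thieves : ℝ) / n) ≤
      stealFactor ^ ((s.thieves : ℝ) / (n + 1 : ℕ)) := by
    refine Real.rpow_le_rpow_of_exponent_ge stealFactor_pos stealFactor_lt_one.le ?_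
    gcongr
    omega
  have hhalf := (half_one_add_pow_le hn hr).trans hexp
  rw [hsum, card_draws, card_draws_not_requested hi]
  push_cast [Nat.add_sub_cancel] at hpow hhalf ⊢
  rw [hpow, add_sub_cancel_right]
  have hp : (0 : ℝ) < (n : ℝ) ^ (n + 1) := by positivity
  nlinarith [mul_le_mul_of_nonneg_left hhalf hp.le]

end State

/-! ### Configurations and the request count -/

/-- A configuration together with the depths in the enabling tree and the number of slots that began
with an unexecuted task. -/
structure Config (m : ℕ) (V : Type*) where
  state : State m V
  depth : V → ℕ
  clock : ℕ

instance {m : ℕ} {V : Type*} [Finite V] : Countable (State m V) :=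
  Function.Injective.countable (β := (Fin m → List V) × Set V)
    (f := fun s => (s.deque, s.executed)) fun s s' h => by
      cases s
      cases s'
      simpa using h

instance {m : ℕ} {V : Type*} [Finite V] : Countable (Config m V) :=
  Function.Injective.countable (β := State m V × (V → ℕ) × ℕ)
    (f := fun z => (z.state, z.depth, z.clock)) fun z z' h => by
      cases z
      cases z'
      simpa using h

namespace Config

variable {m : ℕ} {V : Type*} {G : Digraph V} {z : Config m V}

open Classical in
/-- The configuration after a slot that leads to the state `s'`. -/
noncomputable def next (z : Config m V) (s' : State m V) : Config m V where
  state := s'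
  depth := z.state.nextDepth s' z.depth
  clock := if z.state.executed = Set.univ then z.clock else z.clock + 1

/-- The number of steal requests up to a configuration. -/
noncomputable def requests (z : Config m V) : ℝ := (m : ℝ) * z.clock - z.state.executed.ncard

/-- The invariants of an execution. -/
structure Good (G : Digraph V) (z : Config m V) : Prop where
  valid : z.state.Valid G
  layered : z.state.Layered G z.depth
  ncard_executed_le : z.state.executed.ncard ≤ m * z.clock
  clock_le : z.state.executed ≠ Set.univ → z.clock ≤ z.state.executed.ncard

lemma Good.requests_nonneg (hz : z.Good G) : 0 ≤ z.requests := by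
  rw [requests, sub_nonneg]
  exact_mod_cast hz.ncard_executed_le

lemma good_of_isInitial {root : V} (source : ∀ v, (∀ u, ¬ G.Adj u v) ↔ v = root)
    {s : State m V} (h : s.IsInitial root) : Good G ⟨s, fun _ => 0, 0⟩ :=
  ⟨State.isValid_of_isInitial source h, State.layered_of_isInitial h, by simp [h.1],
    fun _ => Nat.zero_le _⟩

variable {s' : State m V} {f : Fin m → Fin m}

lemma executed_next (h : z.state.Step G f s') (hf : z.state.executed = Set.univ) :
    (z.next s').state.executed = Set.univ := by
  refine h.1.trans ?_
  rw [State.executedAfter, hf, Set.univ_union]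

lemma requests_next_of_eq_univ (h : z.state.Step G f s') (hf : z.state.executed = Set.univ) :
    (z.next s').requests = z.requests := by
  rw [requests, requests, executed_next h hf, hf, next]
  simp only [hf, if_true]

variable [Finite V]

/-- Of the m processors counted by one tick of the clock, those that execute no task are the
thieves. -/
lemma Good.requests_next (hz : z.Good G) (h : z.state.Step G f s')
    (hf : z.state.executed ≠ Set.univ) :
    (z.next s').requests = z.requests + z.state.thieves := by
  have hcard := hz.valid.ncard_executedAfter
  rw [← h.1] at hcard
  have hcard' : (s'.executed.ncard : ℝ) + z.state.thieves = z.state.executed.ncard + m := by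
    exact_mod_cast hcard
  rw [requests, requests, next]
  simp only [hf, if_false]
  push_cast
  linarith

lemma Good.next (acyclic : ∀ v, ¬ Relation.TransGen G.Adj v v)
    (outdegree : ∀ v, {w | G.Adj v w}.ncard ≤ 2) (hz : z.Good G) (h : z.state.Step G f s') :
    (z.next s').Good G := by
  obtain ⟨c, winner, hc⟩ := h.exists_stepWith
  refine ⟨hc.valid hz.valid, hc.layered outdegree hz.valid hz.layered, ?_, fun hf' => ?_⟩
  · by_cases hf : z.state.executed = Set.univ
    · have := hz.ncard_executed_le
      rw [executed_next h hf, ← hf]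
      simpa [Config.next, hf] using this
    · have h1 := hz.requests_nonneg
      have h2 := hz.requests_next h hf
      have h3 : 0 ≤ (z.next s').requests := by
        rw [h2]
        positivity
      rw [requests, sub_nonneg] at h3
      exact_mod_cast h3
  -- Some processor is active, so every counted slot executes at least one task.
  · have hf : z.state.executed ≠ Set.univ := fun hf => hf' (executed_next h hf)
    obtain ⟨i, hi⟩ := hz.valid.exists_deque_ne_nil acyclic hf
    have hcard := hz.valid.ncard_executedAfter
    rw [← h.1] at hcard
    have := hz.clock_le hf
    have := State.thieves_lt hi
    simp only [Config.next, hf, if_false]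
    omega

end Config

open Classical in
/-- The expected potential after a slot, for a uniform draw of the victims. -/
lemma State.sum_draws_potential_le {m D : ℕ} {V : Type*} (hm : 2 ≤ m) (s : State m V) (d : V → ℕ) :
    ∑ f ∈ State.draws m, ((∑ i, dequePotential (fun v => D - d v) (s.deque i) *
        (if ∃ j, s.Requests f j i then 1 else 2) : ℕ) : ENNReal) / 2 ≤
      ((m : ENNReal) - 1) ^ m *
        (ENNReal.ofReal (stealFactor ^ ((s.thieves : ℝ) / m)) * s.potential D d) := by
  set φ : Fin m → ℕ := fun i => dequePotential (fun v => D - d v) (s.deque i) with hφ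
  have hreal : ∑ f ∈ State.draws m, ((∑ i, φ i *
        (if ∃ j, s.Requests f j i then 1 else 2) : ℕ) : ℝ) / 2 ≤
      ((m : ℝ) - 1) ^ m * (stealFactor ^ ((s.thieves : ℝ) / m) * s.potential D d) := by
    rw [← Finset.sum_div, div_le_iff₀ two_pos]
    push_cast
    rw [Finset.sum_comm, State.potential]
    push_cast
    rw [Finset.mul_sum, Finset.mul_sum, Finset.sum_mul]
    refine Finset.sum_le_sum fun i _ => ?_
    rw [← Finset.mul_sum]
    by_cases hi : s.deque i = []
    · simp [hφ, hi, dequePotential_nil]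
    · have := mul_le_mul_of_nonneg_left (State.sum_draws_le hm hi)
        (Nat.cast_nonneg (α := ℝ) (φ i))
      linarith
  obtain ⟨N, hN⟩ : ∃ N : (Fin m → Fin m) → ℕ, ∀ f, N f = ∑ i, φ i *
      (if ∃ j, s.Requests f j i then 1 else 2) := ⟨_, fun _ => rfl⟩
  simp only [← hN] at hreal
  refine (Finset.sum_le_sum (g := fun f => (N f : ENNReal) / 2) fun f _ => by rw [hN]).trans ?_
  have hm1 : (0 : ℝ) ≤ (m : ℝ) - 1 := by
    rw [sub_nonneg]
    exact_mod_cast (by omega : 1 ≤ m)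
  have := ENNReal.ofReal_le_ofReal hreal
  rw [ENNReal.ofReal_sum_of_nonneg fun _ _ => by positivity,
    ENNReal.ofReal_mul (by positivity), ENNReal.ofReal_mul (by have := stealFactor_pos; positivity),
    ENNReal.ofReal_pow hm1, ENNReal.ofReal_sub _ zero_le_one] at this
  simpa [ENNReal.ofReal_div_of_pos] using this

/-! ### Integration over uniform draws -/

section Probability

variable {Ω Z : Type*} {mΩ : MeasurableSpace Ω} {m : ℕ} {μ : Measure Ω}

lemma lintegral_comp_eq_tsum [Countable Z] {X : Ω → Z} (hX : ∀ z, MeasurableSet {ω | X ω = z})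
    (g : Z → ENNReal) : ∫⁻ ω, g (X ω) ∂μ = ∑' z, g z * μ {ω | X ω = z} := by
  let _ : MeasurableSpace Z := ⊤
  have hX' : Measurable X := measurable_to_countable' fun z => hX z
  rw [← lintegral_map (f := g) measurable_from_top hX', lintegral_countable']
  refine tsum_congr fun z => ?_
  rw [Measure.map_apply hX' (measurableSet_singleton z)]
  rfl

/-- Integration over the draws of a slot, which are uniform given the past. -/
lemma lintegral_draws [IsProbabilityMeasure μ] [Countable Z] (hm : 2 ≤ m)
    {𝓕 : MeasurableSpace Ω} (h𝓕 : 𝓕 ≤ mΩ) {X : Ω → Z} {Y : Ω → Fin m → Fin m}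
    (hX : ∀ z, MeasurableSet[𝓕] {ω | X ω = z}) (hY : ∀ f, MeasurableSet[mΩ] {ω | Y ω = f})
    (uniform : ∀ A, MeasurableSet[𝓕] A → ∀ f : Fin m → Fin m, (∀ i, f i ≠ i) →
      μ (A ∩ {ω | Y ω = f}) = μ A / ((m : ENNReal) - 1) ^ m)
    (g : Z → (Fin m → Fin m) → ENNReal) :
    ∫⁻ ω, g (X ω) (Y ω) ∂μ =
      ∫⁻ ω, (∑ f ∈ State.draws m, g (X ω) f) / ((m : ENNReal) - 1) ^ m ∂μ := by
  classical
  set N : ENNReal := ((m : ENNReal) - 1) ^ m with hN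
  have hNcard : N = ((State.draws m).card : ENNReal) := by
    rw [hN, State.card_draws]
    push_cast
    rfl
  have hN0 : N ≠ 0 := by
    rw [hNcard, State.card_draws, Nat.cast_ne_zero]
    exact pow_ne_zero _ (by omega)
  have hNt : N ≠ ⊤ := by
    rw [hNcard]
    exact ENNReal.natCast_ne_top _
  have hdraw : ∀ f ∈ State.draws m, μ {ω | Y ω = f} = N⁻¹ := fun f hf => by
    simpa [one_div] using uniform Set.univ MeasurableSet.univ f (State.mem_draws.1 hf)
  -- The admissible draws already have total mass 1, so the others, on which `uniform` is silent,
  -- are null.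
  have hall : ∑ f ∈ State.draws m, μ {ω | Y ω = f} = 1 := by
    rw [Finset.sum_congr rfl hdraw, Finset.sum_const, nsmul_eq_mul, ← hNcard,
      ENNReal.mul_inv_cancel hN0 hNt]
  have htotal : ∑ f, μ {ω | Y ω = f} = 1 := by
    have h := lintegral_comp_eq_tsum (μ := μ) hY fun _ => 1
    simpa [tsum_fintype] using h.symm
  have hzero : ∀ f, f ∉ State.draws m → μ {ω | Y ω = f} = 0 := by
    rw [← Finset.sum_add_sum_compl (State.draws m), hall] at htotal
    have h0 : ∑ f ∈ (State.draws m)ᶜ, μ {ω | Y ω = f} = 0 := by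
      have h1 : (1 : ENNReal) + ∑ f ∈ (State.draws m)ᶜ, μ {ω | Y ω = f} = 1 + 0 := by
        rw [htotal, add_zero]
      exact (ENNReal.add_right_inj ENNReal.one_ne_top).1 h1
    intro f hf
    exact (Finset.sum_eq_zero_iff.1 h0) f (Finset.mem_compl.2 hf)
  have hpair := lintegral_comp_eq_tsum (μ := μ) (X := fun ω => (X ω, Y ω))
    (fun p => by
      have : {ω | (X ω, Y ω) = p} = {ω | X ω = p.1} ∩ {ω | Y ω = p.2} := by
        ext ω
        simp [Prod.ext_iff]
      rw [this]
      exact (h𝓕 _ (hX p.1)).inter (hY p.2))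
    (fun p => g p.1 p.2)
  have hsplit : ∀ z f, μ {ω | (X ω, Y ω) = (z, f)} =
      if f ∈ State.draws m then μ {ω | X ω = z} / N else 0 := fun z f => by
    have hset : {ω | (X ω, Y ω) = (z, f)} = {ω | X ω = z} ∩ {ω | Y ω = f} := by
      ext ω
      simp [Prod.ext_iff]
    rw [hset]
    split_ifs with hf
    · exact uniform _ (hX z) f (State.mem_draws.1 hf)
    · exact measure_mono_null Set.inter_subset_right (hzero f hf)
  rw [hpair, ENNReal.tsum_prod (f := fun z f => g z f * μ {ω | (X ω, Y ω) = (z, f)}),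
    lintegral_comp_eq_tsum (fun z => h𝓕 _ (hX z))
      fun z => (∑ f ∈ State.draws m, g z f) / N]
  refine tsum_congr fun z => ?_
  rw [tsum_fintype]
  simp only [hsplit, mul_ite, mul_zero]
  rw [Finset.sum_ite_mem, Finset.univ_inter, ← Finset.sum_mul, div_eq_mul_inv, div_eq_mul_inv]
  ring

end Probability

/-! ### Supermartingales along an execution -/

section Execution

variable {Ω V : Type*} {mΩ : MeasurableSpace Ω} {m : ℕ} {μ : Measure Ω} {ℱ : Filtration ℕ mΩ}
  {G : Digraph V} {root : V} {state : ℕ → Ω → State m V} {victim : ℕ → Ω → Fin m → Fin m}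

/-- The configuration at the beginning of slot `t`. -/
noncomputable def config (state : ℕ → Ω → State m V) : ℕ → Ω → Config m V
  | 0, ω => ⟨state 0 ω, fun _ => 0, 0⟩
  | t + 1, ω => (config state t ω).next (state (t + 1) ω)

lemma config_state (t : ℕ) (ω : Ω) : (config state t ω).state = state t ω := by
  cases t <;> rfl

namespace IsExecution

lemma step_config (exec : IsExecution μ ℱ G root state victim) (t : ℕ) (ω : Ω) :
    (config state t ω).state.Step G (victim t ω) (state (t + 1) ω) := by
  rw [config_state]
  exact exec.step t ω

variable [Finite V]

/-- Depths and clock are computed from the states so far; the previous configuration ranges over a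
countable set. -/
lemma measurableSet_config (exec : IsExecution μ ℱ G root state victim) (t : ℕ)
    (z : Config m V) : MeasurableSet[ℱ t] {ω | config state t ω = z} := by
  induction t generalizing z with
  | zero =>
    have : {ω | config state 0 ω = z} =
        {ω | state 0 ω = z.state ∧ (⟨z.state, fun _ => 0, 0⟩ : Config m V) = z} := by
      ext ω
      constructor
      · rintro rfl
        exact ⟨rfl, rfl⟩
      · rintro ⟨h1, h2⟩
        rw [← h1] at h2
        exact h2
    rw [this]
    by_cases h : (⟨z.state, fun _ => 0, 0⟩ : Config m V) = z
    · simpa [h] using exec.adapted_state 0 z.state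
    · simp [h]
  | succ t ih =>
    have : {ω | config state (t + 1) ω = z} = ⋃ z₀ ∈ {z₀ : Config m V | z₀.next z.state = z},
        {ω | config state t ω = z₀} ∩ {ω | state (t + 1) ω = z.state} := by
      ext ω
      simp only [Set.mem_iUnion, exists_prop]
      constructor
      · rintro rfl
        exact ⟨_, rfl, rfl, rfl⟩
      · rintro ⟨z₀, h, h1, h2⟩
        change (config state t ω).next (state (t + 1) ω) = z
        rw [show config state t ω = z₀ from h1, show state (t + 1) ω = z.state from h2]
        exact h
    rw [this]
    exact MeasurableSet.biUnion (Set.to_countable _) fun z₀ _ =>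
      (ℱ.mono (Nat.le_succ t) _ (ih z₀)).inter (exec.adapted_state (t + 1) z.state)

lemma good_config (acyclic : ∀ v, ¬ Relation.TransGen G.Adj v v)
    (source : ∀ v, (∀ u, ¬ G.Adj u v) ↔ v = root) (outdegree : ∀ v, {w | G.Adj v w}.ncard ≤ 2)
    (exec : IsExecution μ ℱ G root state victim) (t : ℕ) (ω : Ω) :
    (config state t ω).Good G := by
  induction t with
  | zero => exact Config.good_of_isInitial source (exec.initial ω)
  | succ t ih => exact ih.next acyclic outdegree (exec.step_config t ω)

/-- A function `U` of the configuration is a supermartingale if `A + B * potential` bounds its next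
value and if replacing the next potential by the bound on its expectation does not exceed `U`. -/
lemma lintegral_config_succ_le [IsProbabilityMeasure μ] {D : ℕ}
    (acyclic : ∀ v, ¬ Relation.TransGen G.Adj v v)
    (source : ∀ v, (∀ u, ¬ G.Adj u v) ↔ v = root) (outdegree : ∀ v, {w | G.Adj v w}.ncard ≤ 2)
    (critical : IsCriticalPath G D)
    (exec : IsExecution μ ℱ G root state victim) (A B U : Config m V → ENNReal)
    (hfin : ∀ z z' : Config m V, z.state.executed = Set.univ → z'.state.executed = Set.univ →
      z'.requests = z.requests → U z' ≤ U z)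
    (hnext : ∀ z z' : Config m V, z.Good G → z'.Good G → z.state.executed ≠ Set.univ →
      z'.requests = z.requests + z.state.thieves →
      U z' ≤ A z + B z * z'.state.potential D z'.depth)
    (hU : ∀ z : Config m V, z.Good G → z.state.executed ≠ Set.univ →
      A z + B z * (ENNReal.ofReal (stealFactor ^ ((z.state.thieves : ℝ) / m)) *
        z.state.potential D z.depth) ≤ U z) (t : ℕ) :
    ∫⁻ ω, U (config state (t + 1) ω) ∂μ ≤ ∫⁻ ω, U (config state t ω) ∂μ := by
  classical
  -- This bound on the next potential sees only the configuration and the draw, so the arbitrary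
  -- choices may depend on the draw of the slot.
  let Ψ : Config m V → (Fin m → Fin m) → ENNReal := fun z f =>
    ((∑ i, dequePotential (fun v => D - z.depth v) (z.state.deque i) *
        (if ∃ j, z.state.Requests f j i then 1 else 2) : ℕ) : ENNReal) / 2
  have hΨ : ∀ t ω, ((config state (t + 1) ω).state.potential D (config state (t + 1) ω).depth :
      ENNReal) ≤ Ψ (config state t ω) (victim t ω) := fun t ω => by
    have hg := exec.good_config acyclic source outdegree t ω
    obtain ⟨c, winner, hc⟩ := (exec.step_config t ω).exists_stepWith
    have h := hc.two_mul_potential_le outdegree critical hg.valid hg.layered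
    rw [ENNReal.le_div_iff_mul_le (by simp) (by simp), mul_comm]
    exact_mod_cast h
  let g : Config m V → (Fin m → Fin m) → ENNReal := fun z f =>
    if z.Good G ∧ z.state.executed ≠ Set.univ then A z + B z * Ψ z f else U z
  have hpoint : ∀ ω, U (config state (t + 1) ω) ≤ g (config state t ω) (victim t ω) := fun ω => by
    have hg := exec.good_config acyclic source outdegree t ω
    have hstep := exec.step_config t ω
    by_cases hf : (config state t ω).state.executed = Set.univ
    · simp only [g, hf, ne_eq, not_true_eq_false, and_false, if_false]
      exact hfin _ _ hf (Config.executed_next hstep hf) (Config.requests_next_of_eq_univ hstep hf)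
    · simp only [g, if_pos (And.intro hg hf)]
      refine (hnext _ _ hg (hg.next acyclic outdegree hstep) hf (hg.requests_next hstep hf)).trans ?_
      gcongr
      exact hΨ t ω
  refine (lintegral_mono hpoint).trans ?_
  by_cases hm : 2 ≤ m
  · rw [lintegral_draws hm (ℱ.le t) (exec.measurableSet_config t)
      (fun f => ℱ.le _ _ (exec.adapted_victim t f)) (exec.uniform_victim t)]
    refine lintegral_mono fun ω => ?_
    generalize config state t ω = z
    have hcard : ((State.draws m).card : ENNReal) = ((m : ENNReal) - 1) ^ m := by
      rw [State.card_draws]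
      push_cast
      rfl
    refine ENNReal.div_le_of_le_mul' ?_
    by_cases hz : z.Good G ∧ z.state.executed ≠ Set.univ
    · simp only [g, if_pos hz]
      rw [Finset.sum_add_distrib, Finset.sum_const, nsmul_eq_mul, hcard, ← Finset.mul_sum]
      calc _ ≤ ((m : ENNReal) - 1) ^ m * A z + B z * (((m : ENNReal) - 1) ^ m *
            (ENNReal.ofReal (stealFactor ^ ((z.state.thieves : ℝ) / m)) *
              z.state.potential D z.depth)) := by
            gcongr
            exact State.sum_draws_potential_le hm z.state z.depth
        _ = ((m : ENNReal) - 1) ^ m * (A z + B z *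
            (ENNReal.ofReal (stealFactor ^ ((z.state.thieves : ℝ) / m)) *
              z.state.potential D z.depth)) := by ring
        _ ≤ _ := by
          gcongr
          exact hU z hz.1 hz.2
    · simp only [g, if_neg hz]
      rw [Finset.sum_const, nsmul_eq_mul, hcard]
  -- With at most one processor uniformity is of no use, but an active processor leaves no thief:
  -- the factor is 1 and a pointwise bound suffices.
  · refine lintegral_mono fun ω => ?_
    generalize config state t ω = z
    by_cases hz : z.Good G ∧ z.state.executed ≠ Set.univ
    · simp only [g, if_pos hz]
      refine le_trans ?_ (hU z hz.1 hz.2)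
      obtain ⟨i, hi⟩ := hz.1.valid.exists_deque_ne_nil acyclic hz.2
      have hlt := State.thieves_lt hi
      have h0 : z.state.thieves = 0 := by omega
      rw [h0, Nat.cast_zero, zero_div, Real.rpow_zero, ENNReal.ofReal_one, one_mul]
      gcongr
      refine ENNReal.div_le_of_le_mul ?_
      rw [State.potential]
      norm_cast
      rw [Finset.sum_mul]
      refine Finset.sum_le_sum fun i _ => Nat.mul_le_mul_left _ ?_
      split_ifs <;> norm_num
    · simp only [g, if_neg hz, le_refl]

end IsExecution

end Execution

/-! ### Numerical constants -/

lemma log_stealFactor_neg : Real.log stealFactor < 0 :=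
  Real.log_neg stealFactor_pos stealFactor_lt_one

/-- The constant `λ / log 2` of the bounds on the number of steal requests. -/
noncomputable def requestCost : ℝ := 1 / (-Real.log stealFactor)

lemma requestCost_pos : 0 < requestCost :=
  one_div_pos.2 (neg_pos.2 log_stealFactor_neg)

lemma requestCost_mul_log_stealFactor : requestCost * Real.log stealFactor = -1 := by
  have := log_stealFactor_neg.ne
  unfold requestCost
  field_simp

/-- The denominator 1 - log₂(1 + 1/e) is -log₂ κ. -/
lemma three_div_eq :
    3 / (1 - Real.logb 2 (1 + 1 / Real.exp 1)) = 3 * Real.log 2 * requestCost := by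
  have hpos : 0 < 1 + Real.exp (-1) := by positivity
  have hlog : Real.log stealFactor = Real.log (1 + Real.exp (-1)) - Real.log 2 := by
    rw [stealFactor, Real.log_div hpos.ne' two_ne_zero]
  have h2 : Real.log 2 ≠ 0 := (Real.log_pos one_lt_two).ne'
  have hne := log_stealFactor_neg.ne
  have h1 : 1 - Real.logb 2 (1 + 1 / Real.exp 1) = -Real.log stealFactor / Real.log 2 := by
    rw [hlog, Real.logb, one_div, ← Real.exp_neg]
    field_simp
    ring
  rw [h1, requestCost]
  field_simp

/-- The target 5/11 is chosen because 3/(1 - 5/11) = 5.5. -/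
lemma logb_lt : Real.logb 2 (1 + 1 / Real.exp 1) < 5 / 11 := by
  have he : 1 / Real.exp 1 < 0.36788 := by
    rw [div_lt_iff₀ (Real.exp_pos 1)]
    linarith [Real.exp_one_gt_d9]
  have hpos : 0 < 1 + 1 / Real.exp 1 := by positivity
  have h : Real.logb 2 ((1 + 1 / Real.exp 1) ^ 11) < 5 := by
    rw [Real.logb_lt_iff_lt_rpow one_lt_two (by positivity)]
    calc (1 + 1 / Real.exp 1) ^ 11 ≤ (1.36788 : ℝ) ^ 11 :=
          pow_le_pow_left₀ hpos.le (by linarith) 11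
      _ < 2 ^ (5 : ℝ) := by norm_num
  rw [Real.logb_pow] at h
  push_cast at h
  linarith

/-- Here 3/(1 - 5/14) = 14/3, just what the mean bound needs at D = 3, where W ≤ 15 = 3·(14/3) + 1.
-/
lemma lt_logb : 5 / 14 < Real.logb 2 (1 + 1 / Real.exp 1) := by
  have he : 0.36 < 1 / Real.exp 1 := by
    rw [lt_div_iff₀ (Real.exp_pos 1)]
    linarith [Real.exp_one_lt_d9]
  have h : 5 < Real.logb 2 ((1 + 1 / Real.exp 1) ^ 14) := by
    rw [Real.lt_logb_iff_rpow_lt one_lt_two (by positivity)]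
    calc (2 : ℝ) ^ (5 : ℝ) < (1.36 : ℝ) ^ 14 := by norm_num
      _ ≤ (1 + 1 / Real.exp 1) ^ 14 := pow_le_pow_left₀ (by norm_num) (by linarith) 14
  rw [Real.logb_pow] at h
  push_cast at h
  linarith

lemma three_div_lt : 3 / (1 - Real.logb 2 (1 + 1 / Real.exp 1)) < 5.5 := by
  have := logb_lt
  rw [div_lt_iff₀ (by linarith)]
  linarith

lemma lt_three_div : 14 / 3 < 3 / (1 - Real.logb 2 (1 + 1 / Real.exp 1)) := by
  have := logb_lt
  have := lt_logb
  rw [lt_div_iff₀ (by linarith)]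
  linarith

lemma log_runPotential_le (D : ℕ) : Real.log (runPotential D) ≤ 3 * Real.log 2 * D := by
  have h : (runPotential D : ℝ) ≤ 2 ^ (3 * D) := by
    rw [pow_mul]
    exact_mod_cast runPotential_le_eight_pow D
  have := Real.log_le_log (by exact_mod_cast runPotential_pos D) h
  rw [Real.log_pow] at this
  push_cast at this
  linarith

/-- The factor (8/7)^D pays for e from D = 4 on: 4·7³·e ≤ 8⁴, while 4·7²·e > 8³. -/
lemma log_runPotential_add_one_le {D : ℕ} (hD : 4 ≤ D) :
    Real.log (runPotential D) + 1 ≤ 3 * Real.log 2 * D := by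
  obtain ⟨n, rfl⟩ := Nat.exists_eq_add_of_le' hD
  have h7 : (7 : ℝ) ^ n ≤ 8 ^ n := pow_le_pow_left₀ (by norm_num) (by norm_num) n
  have hrun : (runPotential (n + 4) : ℝ) = 1372 * 7 ^ n := by
    have : runPotential (n + 4) = 4 * 7 ^ (n + 3) := rfl
    rw [this, pow_add]
    push_cast
    ring
  have h : (runPotential (n + 4) : ℝ) * Real.exp 1 ≤ 2 ^ (3 * (n + 4)) := by
    have h8 : (2 : ℝ) ^ (3 * (n + 4)) = 4096 * 8 ^ n := by
      rw [mul_add, pow_add, pow_mul]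
      norm_num
      ring
    rw [hrun, h8]
    have he := Real.exp_one_lt_d9
    have hn : (0 : ℝ) < 7 ^ n := by positivity
    nlinarith
  have hpos : (0 : ℝ) < runPotential (n + 4) := by exact_mod_cast runPotential_pos _
  have := Real.log_le_log (by positivity) h
  rw [Real.log_mul hpos.ne' (Real.exp_pos 1).ne', Real.log_exp, Real.log_pow] at this
  push_cast at this ⊢
  linarith

/-! ### Size of the graph in terms of its depth -/

/-- A graph with one source, out-degrees at most two and depth `D` has fewer than `2 ^ (D + 1)`
vertices. -/
lemma card_lt_of_isCriticalPath {V : Type*} [Fintype V] {G : Digraph V} {root : V} {D : ℕ}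
    (acyclic : ∀ v, ¬ Relation.TransGen G.Adj v v)
    (source : ∀ v, (∀ u, ¬ G.Adj u v) ↔ v = root)
    (outdegree : ∀ v, {w | G.Adj v w}.ncard ≤ 2)
    (critical : IsCriticalPath G D) : Fintype.card V < 2 ^ (D + 1) := by
  classical
  -- `level n` consists of the ends of the `n`-edge paths from `root`; levels may overlap, but
  -- together they cover the graph.
  let level : ℕ → Finset V := fun n => Nat.rec {root}
    (fun _ S => S.biUnion fun v => (Set.toFinite {w | G.Adj v w}).toFinset) n
  have hcard : ∀ n, (level n).card ≤ 2 ^ n := fun n => by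
    induction n with
    | zero => simp [level]
    | succ n ih =>
      refine (Finset.card_biUnion_le_card_mul _ _ 2 fun v _ => ?_).trans ?_
      · rw [← Set.ncard_eq_toFinset_card]
        exact outdegree v
      · rw [pow_succ]
        exact Nat.mul_le_mul_right 2 ih
  have hsucc : ∀ n v, v ∈ level (n + 1) ↔ ∃ u ∈ level n, G.Adj u v := fun n v => by
    simp [level]
  have hpath : ∀ n v, v ∈ level n →
      ∃ p : List V, p.IsChain G.Adj ∧ p.length = n + 1 ∧ p.getLast? = some v := fun n => by
    induction n with
    | zero => exact fun v _ => ⟨[v], by simp⟩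
    | succ n ih =>
      intro v hv
      obtain ⟨u, hu, huv⟩ := (hsucc n v).1 hv
      obtain ⟨p, hp, hlen, hlast⟩ := ih u hu
      refine ⟨p ++ [v], ?_, by simp [hlen], by simp⟩
      rw [List.isChain_append]
      refine ⟨hp, by simp, fun x hx y hy => ?_⟩
      rw [hlast] at hx
      simp only [Option.mem_def, Option.some.injEq, List.head?_cons] at hx hy
      rwa [← hx, ← hy]
  have : IsTrans V (Relation.TransGen G.Adj) := ⟨fun _ _ _ => Relation.TransGen.trans⟩
  have : Std.Irrefl (Relation.TransGen G.Adj) := ⟨acyclic⟩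
  have wf : WellFounded (Relation.TransGen G.Adj) := Finite.wellFounded_of_trans_of_irrefl _
  have hlevel : ∀ v, ∃ n, v ∈ level n := fun v => by
    induction v using wf.induction with
    | _ v ih =>
      by_cases hv : ∀ u, ¬ G.Adj u v
      · exact ⟨0, by simp [level, (source v).1 hv]⟩
      · push Not at hv
        obtain ⟨u, hu⟩ := hv
        obtain ⟨n, hn⟩ := ih u (.single hu)
        exact ⟨n + 1, (hsucc n v).2 ⟨u, hn, hu⟩⟩
  have huniv : (Finset.univ : Finset V) ⊆ (Finset.range (D + 1)).biUnion level := fun v _ => by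
    obtain ⟨n, hn⟩ := hlevel v
    obtain ⟨p, hp, hlen, -⟩ := hpath n v hn
    exact Finset.mem_biUnion.2
      ⟨n, Finset.mem_range.2 (Nat.lt_succ_of_le (critical.2 ⟨p, hp, hlen⟩)), hn⟩
  calc Fintype.card V ≤ ((Finset.range (D + 1)).biUnion level).card := Finset.card_le_card huniv
    _ ≤ ∑ n ∈ Finset.range (D + 1), (level n).card := Finset.card_biUnion_le
    _ ≤ ∑ n ∈ Finset.range (D + 1), 2 ^ n := Finset.sum_le_sum fun n _ => hcard n
    _ < 2 ^ (D + 1) := Nat.geomSum_lt le_rfl fun n hn => Finset.mem_range.1 hn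

/-! ### Makespan, clock and a deterministic horizon -/

namespace IsExecution

variable {Ω V : Type*} {mΩ : MeasurableSpace Ω} {m : ℕ} {μ : Measure Ω} {ℱ : Filtration ℕ mΩ}
  {G : Digraph V} {root : V} {state : ℕ → Ω → State m V} {victim : ℕ → Ω → Fin m → Fin m} {D : ℕ}

lemma executed_succ (exec : IsExecution μ ℱ G root state victim) {t : ℕ} {ω : Ω}
    (h : (state t ω).executed = Set.univ) : (state (t + 1) ω).executed = Set.univ := by
  rw [← config_state (state := state) t ω] at h
  exact Config.executed_next (exec.step_config t ω) h

lemma clock_config_succ (state : ℕ → Ω → State m V) (t : ℕ) (ω : Ω) [Decidable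
    ((state t ω).executed = Set.univ)] : (config state (t + 1) ω).clock =
      if (state t ω).executed = Set.univ then (config state t ω).clock
      else (config state t ω).clock + 1 := by
  change ((config state t ω).next _).clock = _
  simp only [Config.next, config_state]

lemma clock_config_of_ne (exec : IsExecution μ ℱ G root state victim) {t : ℕ} {ω : Ω}
    (h : (state t ω).executed ≠ Set.univ) : (config state t ω).clock = t := by
  classical
  induction t with
  | zero => rfl
  | succ t ih =>
    have ht : (state t ω).executed ≠ Set.univ := fun ht => h (exec.executed_succ ht)
    rw [clock_config_succ, if_neg ht, ih ht]

lemma clock_config_of_makespan_le (exec : IsExecution μ ℱ G root state victim) {ω : Ω}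
    (hex : ∃ t, (state t ω).executed = Set.univ) {t : ℕ} (ht : makespan state ω ≤ t) :
    (config state t ω).clock = makespan state ω ∧ (state t ω).executed = Set.univ := by
  classical
  induction t, ht using Nat.le_induction with
  | base =>
    refine ⟨?_, Nat.sInf_mem hex⟩
    rcases hT : makespan state ω with _ | k
    · rfl
    · have hk : (state k ω).executed ≠ Set.univ := fun hk => by
        have : makespan state ω ≤ k := Nat.sInf_le hk
        omega
      rw [clock_config_succ, if_neg hk, exec.clock_config_of_ne hk]
  | succ t _ ih => exact ⟨by rw [clock_config_succ, if_pos ih.2, ih.1], exec.executed_succ ih.2⟩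

variable [Fintype V]

/-- An unfinished clock equals the elapsed time and is at most the number of executed tasks. The
fixed horizon W replaces optional stopping. -/
lemma executed_card
    (acyclic : ∀ v, ¬ Relation.TransGen G.Adj v v)
    (source : ∀ v, (∀ u, ¬ G.Adj u v) ↔ v = root) (outdegree : ∀ v, {w | G.Adj v w}.ncard ≤ 2)
    (exec : IsExecution μ ℱ G root state victim) (ω : Ω) : (state (Fintype.card V) ω).executed = Set.univ := by
  by_contra h
  have hg := exec.good_config acyclic source outdegree (Fintype.card V) ω
  have hc := exec.clock_config_of_ne h
  have hle := hg.clock_le (by rwa [config_state])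
  rw [hc, config_state] at hle
  refine h (Set.eq_of_subset_of_ncard_le (Set.subset_univ _) ?_)
  rwa [Set.ncard_univ, Nat.card_eq_fintype_card]

lemma makespan_le_card
    (acyclic : ∀ v, ¬ Relation.TransGen G.Adj v v)
    (source : ∀ v, (∀ u, ¬ G.Adj u v) ↔ v = root) (outdegree : ∀ v, {w | G.Adj v w}.ncard ≤ 2)
    (exec : IsExecution μ ℱ G root state victim) (ω : Ω) : makespan state ω ≤ Fintype.card V :=
  Nat.sInf_le (exec.executed_card acyclic source outdegree ω)

lemma clock_config_card
    (acyclic : ∀ v, ¬ Relation.TransGen G.Adj v v)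
    (source : ∀ v, (∀ u, ¬ G.Adj u v) ↔ v = root) (outdegree : ∀ v, {w | G.Adj v w}.ncard ≤ 2)
    (exec : IsExecution μ ℱ G root state victim) (ω : Ω) :
    (config state (Fintype.card V) ω).clock = makespan state ω :=
  (exec.clock_config_of_makespan_le ⟨_, exec.executed_card acyclic source outdegree ω⟩
    (exec.makespan_le_card acyclic source outdegree ω)).1

lemma requests_config_card
    (acyclic : ∀ v, ¬ Relation.TransGen G.Adj v v)
    (source : ∀ v, (∀ u, ¬ G.Adj u v) ↔ v = root) (outdegree : ∀ v, {w | G.Adj v w}.ncard ≤ 2)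
    (exec : IsExecution μ ℱ G root state victim) (ω : Ω) :
    (config state (Fintype.card V) ω).requests = m * makespan state ω - Fintype.card V := by
  rw [Config.requests, exec.clock_config_card acyclic source outdegree, config_state,
    exec.executed_card acyclic source outdegree, Set.ncard_univ, Nat.card_eq_fintype_card]

end IsExecution

/-! ### Tail and mean of the number of requests -/

namespace IsExecution

variable {Ω V : Type*} {mΩ : MeasurableSpace Ω} {m : ℕ} {μ : Measure Ω} {ℱ : Filtration ℕ mΩ}
  {G : Digraph V} {root : V} {state : ℕ → Ω → State m V} {victim : ℕ → Ω → Fin m → Fin m} {D : ℕ}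

lemma measurableSet_config_mem [Finite V] (exec : IsExecution μ ℱ G root state victim) (t : ℕ)
    (S : Set (Config m V)) : MeasurableSet {ω | config state t ω ∈ S} := by
  have : {ω | config state t ω ∈ S} = ⋃ z ∈ S, {ω | config state t ω = z} := by
    ext ω
    simp
  rw [this]
  exact MeasurableSet.biUnion (Set.to_countable S) fun z _ =>
    ℱ.le t _ (exec.measurableSet_config t z)

lemma one_le_potential [Finite V] (acyclic : ∀ v, ¬ Relation.TransGen G.Adj v v)
    {z : Config m V} (hz : z.Good G) (hf : z.state.executed ≠ Set.univ) :
    (1 : ℝ) ≤ z.state.potential D z.depth := by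
  obtain ⟨i, hi⟩ := hz.valid.exists_deque_ne_nil acyclic hf
  exact_mod_cast State.potential_pos hi

lemma thieves_lt_of_ne [Finite V] (acyclic : ∀ v, ¬ Relation.TransGen G.Adj v v)
    {z : Config m V} (hz : z.Good G) (hf : z.state.executed ≠ Set.univ) :
    (z.state.thieves : ℝ) < m := by
  obtain ⟨i, hi⟩ := hz.valid.exists_deque_ne_nil acyclic hf
  exact_mod_cast State.thieves_lt hi

lemma lintegral_config_le [IsProbabilityMeasure μ] (exec : IsExecution μ ℱ G root state victim)
    {U : Config m V → ENNReal} {b : ENNReal}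
    (hU : ∀ t, ∫⁻ ω, U (config state (t + 1) ω) ∂μ ≤ ∫⁻ ω, U (config state t ω) ∂μ)
    (h0 : ∀ s : State m V, s.IsInitial root → U ⟨s, fun _ => 0, 0⟩ ≤ b) (t : ℕ) :
    ∫⁻ ω, U (config state t ω) ∂μ ≤ b := by
  induction t with
  | zero =>
    calc ∫⁻ ω, U (config state 0 ω) ∂μ ≤ ∫⁻ _, b ∂μ :=
          lintegral_mono fun ω => h0 _ (exec.initial ω)
      _ = b := by simp
  | succ t ih => exact (hU t).trans ih

lemma executed_ne_univ_of_isInitial {s : State m V} (h : s.IsInitial root) :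
    s.executed ≠ Set.univ := by
  rw [h.1]
  exact fun he => Set.notMem_empty root (he ▸ Set.mem_univ root)

lemma requests_of_isInitial {s : State m V} (h : s.IsInitial root) :
    Config.requests ⟨s, fun _ => 0, 0⟩ = 0 := by
  simp [Config.requests, h.1]

variable [Fintype V]

/-- Exponential tail of the number of steal requests. -/
lemma measure_requests_le [IsProbabilityMeasure μ] (hm : 1 ≤ m)
    (acyclic : ∀ v, ¬ Relation.TransGen G.Adj v v)
    (source : ∀ v, (∀ u, ¬ G.Adj u v) ↔ v = root) (outdegree : ∀ v, {w | G.Adj v w}.ncard ≤ 2)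
    (critical : IsCriticalPath G D) (exec : IsExecution μ ℱ G root state victim) (x : ℝ) :
    μ {ω | x + m ≤ (config state (Fintype.card V) ω).requests} ≤
      ENNReal.ofReal (runPotential D * stealFactor ^ (x / m)) := by
  classical
  have hm0 : (0 : ℝ) < m := by exact_mod_cast hm
  have hκ := stealFactor_pos
  -- The supermartingale is stopped at level `x`. A slot adds fewer than `m` requests, so reaching
  -- `x + m` at completion means that `x` was reached while a task was unexecuted, when the
  -- potential is at least 1.
  let U : Config m V → ENNReal := fun z =>
    if z.state.executed = Set.univ then (if x + m ≤ z.requests then 1 else 0)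
    else if x ≤ z.requests then 1
    else ENNReal.ofReal (stealFactor ^ ((x - z.requests) / m)) * z.state.potential D z.depth
  have hone : ∀ {y Φ : ℝ}, y ≤ 0 → 1 ≤ Φ → 1 ≤ stealFactor ^ (y / m) * Φ := fun {y Φ} hy hΦ => by
    have : 1 ≤ stealFactor ^ (y / m) :=
      Real.one_le_rpow_of_pos_of_le_one_of_nonpos hκ stealFactor_lt_one.le
        (div_nonpos_of_nonpos_of_nonneg hy hm0.le)
    nlinarith
  have hsup := exec.lintegral_config_succ_le (μ := μ) (D := D) acyclic source outdegree critical
    (A := fun z => if x ≤ z.requests then 1 else 0)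
    (B := fun z => if x ≤ z.requests then 0
      else ENNReal.ofReal (stealFactor ^ ((x - (z.requests + z.state.thieves)) / m)))
    (U := U) (fun z z' hf hf' hr => by simp only [U, hf, hf', hr, if_true, le_refl])
    (fun z z' hz hz' hf hr => ?_) (fun z hz hf => ?_)
  · have h0 := exec.lintegral_config_le hsup (b := ENNReal.ofReal
      (runPotential D * stealFactor ^ (x / m))) (fun s hs => ?_) (Fintype.card V)
    · have hset := exec.measurableSet_config_mem (Fintype.card V) {z | x + m ≤ z.requests}
      refine le_trans (le_of_eq ?_) h0
      refine (lintegral_indicator_one hset).symm.trans (lintegral_congr fun ω => ?_)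
      have hfin := exec.executed_card acyclic source outdegree ω
      rw [← config_state (state := state)] at hfin
      simp only [U, hfin, if_true, Set.indicator_apply, Pi.one_apply]
      rfl
    · simp only [U, if_neg (executed_ne_univ_of_isInitial hs), requests_of_isInitial hs,
        State.potential_of_isInitial D hs, sub_zero]
      split_ifs with hx
      · rw [← ENNReal.ofReal_one]
        refine ENNReal.ofReal_le_ofReal ?_
        rw [mul_comm]
        exact hone hx (by exact_mod_cast runPotential_pos D)
      · rw [mul_comm, ENNReal.ofReal_mul (Nat.cast_nonneg _), ENNReal.ofReal_natCast]
  · have hlt := thieves_lt_of_ne acyclic hz hf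
    by_cases hx : x ≤ z.requests
    · simp only [if_pos hx, zero_mul, add_zero, U]
      by_cases hf' : z'.state.executed = Set.univ
      · simp only [if_pos hf']
        split_ifs <;> simp
      · have hx' : x ≤ z'.requests := by
          rw [hr]
          have : (0 : ℝ) ≤ z.state.thieves := Nat.cast_nonneg _
          linarith
        simp [if_neg hf', if_pos hx']
    · simp only [if_neg hx, zero_add, U, ← hr]
      by_cases hf' : z'.state.executed = Set.univ
      · have hx' : ¬ x + m ≤ z'.requests := by
          rw [hr]
          linarith
        simp [if_pos hf', if_neg hx']
      · rw [if_neg hf']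
        split_ifs with hx'
        · rw [← ENNReal.ofReal_natCast, ← ENNReal.ofReal_mul (by positivity), ← ENNReal.ofReal_one]
          exact ENNReal.ofReal_le_ofReal
            (hone (by linarith) (one_le_potential acyclic hz' hf'))
        · exact le_rfl
  · simp only [U, if_neg hf]
    split_ifs with hx
    · simp
    · rw [zero_add, ← mul_assoc, ← ENNReal.ofReal_mul (by positivity), ← Real.rpow_add hκ]
      refine le_of_eq ?_
      congr 3
      field_simp
      ring

/-- The mean number of steal requests. -/
lemma lintegral_requests_le [IsProbabilityMeasure μ] (hm : 1 ≤ m)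
    (acyclic : ∀ v, ¬ Relation.TransGen G.Adj v v)
    (source : ∀ v, (∀ u, ¬ G.Adj u v) ↔ v = root) (outdegree : ∀ v, {w | G.Adj v w}.ncard ≤ 2)
    (critical : IsCriticalPath G D) (exec : IsExecution μ ℱ G root state victim) :
    ∫⁻ ω, ENNReal.ofReal ((config state (Fintype.card V) ω).requests / m) ∂μ ≤
      ENNReal.ofReal (requestCost * (Real.log (runPotential D) + 1) + 1) := by
  classical
  have hm0 : (0 : ℝ) < m := by exact_mod_cast hm
  have hκ := stealFactor_pos
  have hL := requestCost_pos
  -- At completion the logarithm gives no control. The final `+ 1` covers the requests of the last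
  -- slot; the extra `requestCost` pays for the linear term of the tangent bound, which the
  -- logarithm no longer offsets there.
  let U : Config m V → ENNReal := fun z =>
    if z.state.executed = Set.univ then ENNReal.ofReal (z.requests / m)
    else ENNReal.ofReal
      (z.requests / m + requestCost * (Real.log (z.state.potential D z.depth) + 1) + 1)
  have hsup := exec.lintegral_config_succ_le (μ := μ) (D := D) acyclic source outdegree critical
    (A := fun z => ENNReal.ofReal
      (z.requests / m + requestCost * Real.log (z.state.potential D z.depth) + 1))
    (B := fun z => ENNReal.ofReal (requestCost /
      (stealFactor ^ ((z.state.thieves : ℝ) / m) * z.state.potential D z.depth)))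
    (U := U) (fun z z' hf hf' hr => by simp only [U, hf, hf', hr, if_true, le_refl])
    (fun z z' hz hz' hf hr => ?_) (fun z hz hf => ?_)
  · have h0 := exec.lintegral_config_le hsup (b := ENNReal.ofReal
      (requestCost * (Real.log (runPotential D) + 1) + 1)) (fun s hs => ?_) (Fintype.card V)
    · refine le_trans (le_of_eq (lintegral_congr fun ω => ?_)) h0
      have hfin := exec.executed_card acyclic source outdegree ω
      rw [← config_state (state := state)] at hfin
      simp only [U, hfin, if_true]
    · simp only [U, if_neg (executed_ne_univ_of_isInitial hs), requests_of_isInitial hs,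
        State.potential_of_isInitial D hs, zero_div, zero_add, le_refl]
  · have hr0 := hz.requests_nonneg
    have hlt := thieves_lt_of_ne acyclic hz hf
    have hΦ := one_le_potential (D := D) acyclic hz hf
    have hlog := Real.log_nonneg hΦ
    have hΦ0 : (0 : ℝ) < z.state.potential D z.depth := by linarith
    rw [← ENNReal.ofReal_natCast, ← ENNReal.ofReal_mul (by positivity),
      ← ENNReal.ofReal_add (by positivity) (by positivity)]
    simp only [U]
    split_ifs with hf'
    · refine ENNReal.ofReal_le_ofReal ?_
      have h1 : (z.state.thieves : ℝ) / m ≤ 1 := (div_le_one hm0).2 hlt.le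
      have h2 : 0 ≤ requestCost * Real.log (z.state.potential D z.depth) := by positivity
      have h3 : 0 ≤ requestCost /
        (stealFactor ^ ((z.state.thieves : ℝ) / m) * z.state.potential D z.depth) *
          z'.state.potential D z'.depth := by positivity
      rw [hr, add_div]
      linarith
    · refine ENNReal.ofReal_le_ofReal ?_
      have hΦ' := one_le_potential (D := D) acyclic hz' hf'
      set Φ : ℝ := ((z.state.potential D z.depth : ℕ) : ℝ)
      set Φ' : ℝ := ((z'.state.potential D z'.depth : ℕ) : ℝ)
      set θ : ℝ := (z.state.thieves : ℝ) / m with hθ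
      have hy : 0 < stealFactor ^ θ * Φ := by positivity
      have hly : Real.log (stealFactor ^ θ * Φ) = θ * Real.log stealFactor + Real.log Φ := by
        rw [Real.log_mul (Real.rpow_pos_of_pos hκ _).ne' hΦ0.ne', Real.log_rpow hκ]
      -- The tangent to log at κ^θ·Φ, the bound on the expected next potential, makes the estimate
      -- affine in Φ'.
      have hlog' : Real.log Φ' ≤
          θ * Real.log stealFactor + Real.log Φ + (Φ' / (stealFactor ^ θ * Φ) - 1) := by
        have := Real.log_le_sub_one_of_pos (x := Φ' / (stealFactor ^ θ * Φ)) (by positivity)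
        rw [Real.log_div (by linarith) hy.ne', hly] at this
        linarith
      have hmul := mul_le_mul_of_nonneg_left hlog' hL.le
      have hcost : requestCost * (θ * Real.log stealFactor) = -θ := by
        linear_combination θ * requestCost_mul_log_stealFactor
      have hdiv : requestCost / (stealFactor ^ θ * Φ) * Φ' =
        requestCost * (Φ' / (stealFactor ^ θ * Φ)) := by ring
      rw [hr, add_div, ← hθ, hdiv]
      linarith
  · have hr0 := hz.requests_nonneg
    have hΦ := one_le_potential (D := D) acyclic hz hf
    have hlog := Real.log_nonneg hΦ
    have hΦ0 : (0 : ℝ) < z.state.potential D z.depth := by linarith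
    simp only [U, if_neg hf]
    rw [← ENNReal.ofReal_natCast, ← ENNReal.ofReal_mul (by positivity),
      ← ENNReal.ofReal_mul (by positivity), ← ENNReal.ofReal_add (by positivity) (by positivity)]
    refine ENNReal.ofReal_le_ofReal ?_
    rw [div_mul_cancel₀ _ (by positivity)]
    linarith

end IsExecution

end ABP

/-! ### The theorem -/

open ABP in
theorem theorem5 {V : Type*} [Fintype V] (G : Digraph V) (root : V) (D m : ℕ)
    (acyclic : ∀ v, ¬ Relation.TransGen G.Adj v v)
    (source : ∀ v, (∀ u, ¬ G.Adj u v) ↔ v = root)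
    (outdegree : ∀ v, {w | G.Adj v w}.ncard ≤ 2)
    (critical : ABP.IsCriticalPath G D)
    (hm : 1 ≤ m)
    {Ω : Type*} {mΩ : MeasurableSpace Ω} (μ : Measure Ω) [IsProbabilityMeasure μ]
    (ℱ : Filtration ℕ mΩ)
    (state : ℕ → Ω → ABP.State m V) (victim : ℕ → Ω → Fin m → Fin m)
    (exec : ABP.IsExecution μ ℱ G root state victim) :
    -- every execution terminates, and the makespan has an expectation
    (∀ ω, ∃ t, (state t ω).executed = Set.univ) ∧
    Integrable (fun ω => (ABP.makespan state ω : ℝ)) μ ∧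
    -- (i)
    ∫ ω, (ABP.makespan state ω : ℝ) ∂μ ≤
      (Fintype.card V : ℝ) / m + 3 / (1 - Real.logb 2 (1 + 1 / Real.exp 1)) * D + 1 ∧
    (1 ≤ D →
      (Fintype.card V : ℝ) / m + 3 / (1 - Real.logb 2 (1 + 1 / Real.exp 1)) * D + 1 <
        (Fintype.card V : ℝ) / m + 5.5 * D + 1) ∧
    ∫ ω, (ABP.makespan state ω : ℝ) ∂μ < (Fintype.card V : ℝ) / m + 5.5 * D + 1 ∧
    -- (ii)
    ∀ ε : ℝ, 0 < ε →
      μ.real {ω | (Fintype.card V : ℝ) / m +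
          3 / (1 - Real.logb 2 (1 + 1 / Real.exp 1)) * (D + Real.logb 2 (1 / ε)) + 1 ≤
            (ABP.makespan state ω : ℝ)} ≤ ε := by
  have hm0 : (0 : ℝ) < m := by exact_mod_cast hm
  have hC1 := three_div_lt
  have hC2 := lt_three_div
  have hC3 := three_div_eq
  set C : ℝ := 3 / (1 - Real.logb 2 (1 + 1 / Real.exp 1))
  have hle : ∀ ω, (makespan state ω : ℝ) ≤ Fintype.card V := fun ω => by
    exact_mod_cast exec.makespan_le_card acyclic source outdegree ω
  have hreq := exec.requests_config_card acyclic source outdegree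
  have hreq0 : ∀ ω, 0 ≤ (config state (Fintype.card V) ω).requests := fun ω =>
    (exec.good_config acyclic source outdegree _ ω).requests_nonneg
  have hmeas : Measurable fun ω => (makespan state ω : ℝ) := by
    -- At the horizon W the frozen clock shows the makespan.
    have : Measurable (makespan state) := measurable_to_countable' fun k => by
      have h := exec.measurableSet_config_mem (Fintype.card V) {z | z.clock = k}
      simp only [Set.mem_ofPred_eq, exec.clock_config_card acyclic source outdegree] at h
      exact h
    exact measurable_from_top.comp this
  have hint : Integrable (fun ω => (makespan state ω : ℝ)) μ :=
    Integrable.of_bound hmeas.aestronglyMeasurable (Fintype.card V : ℝ)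
      (Filter.Eventually.of_forall fun ω => by simpa using hle ω)
  have hcardpos : (0 : ℝ) < Fintype.card V := by
    exact_mod_cast Fintype.card_pos_iff.2 ⟨root⟩
  have hW : 0 < (Fintype.card V : ℝ) / m := by positivity
  have hcard := card_lt_of_isCriticalPath acyclic source outdegree critical
  have hmean_le : ∀ b : ℝ, (Fintype.card V : ℝ) ≤ b → ∫ ω, (makespan state ω : ℝ) ∂μ ≤ b :=
    fun b hb => by
      calc ∫ ω, (makespan state ω : ℝ) ∂μ ≤ ∫ _, b ∂μ :=
            integral_mono hint (integrable_const b) fun ω => (hle ω).trans hb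
        _ = b := by simp
  have hmean : ∫ ω, (makespan state ω : ℝ) ∂μ ≤ (Fintype.card V : ℝ) / m + C * D + 1 := by
    by_cases hD : 4 ≤ D
    · have hR := exec.lintegral_requests_le hm acyclic source outdegree critical
      have hfun : ∀ ω, (config state (Fintype.card V) ω).requests / m =
          makespan state ω - (Fintype.card V : ℝ) / m := fun ω => by
        rw [hreq]
        field_simp
      have hlog : 0 ≤ Real.log (runPotential D) :=
        Real.log_nonneg (by exact_mod_cast runPotential_pos D)
      have hL := requestCost_pos
      have hI : ∫ ω, ((makespan state ω : ℝ) - (Fintype.card V : ℝ) / m) ∂μ ≤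
          requestCost * (Real.log (runPotential D) + 1) + 1 := by
        rw [integral_eq_lintegral_of_nonneg_ae
          (Filter.Eventually.of_forall fun ω => by
            rw [← hfun]
            exact div_nonneg (hreq0 ω) hm0.le)
          (hmeas.sub_const _).aestronglyMeasurable]
        simp only [← hfun]
        exact ENNReal.toReal_le_of_le_ofReal (by positivity) hR
      rw [integral_sub hint (integrable_const _)] at hI
      simp only [integral_const, probReal_univ, one_smul] at hI
      have h1 := mul_le_mul_of_nonneg_left (log_runPotential_add_one_le hD) hL.le
      have h2 : requestCost * (3 * Real.log 2 * D) = C * D := by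
        rw [hC3]
        ring
      linarith
    -- For D ≤ 3, 2^(D+1) - 1 ≤ (14/3)·D + 1, with equality at D = 0 and D = 3.
    · refine hmean_le _ ?_
      have hW2 : (Fintype.card V : ℝ) + 1 ≤ 2 ^ (D + 1) := by exact_mod_cast hcard
      have hD' : D < 4 := by omega
      interval_cases D <;> norm_num at hW2 ⊢ <;> linarith
  refine ⟨fun ω => ⟨_, exec.executed_card acyclic source outdegree ω⟩, hint, hmean,
    fun hD => ?_, ?_, fun ε hε => ?_⟩
  · have hD' : (0 : ℝ) < D := by exact_mod_cast hD
    have := mul_lt_mul_of_pos_right hC1 hD'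
    linarith
  · rcases Nat.eq_zero_or_pos D with rfl | hD
    · have h1 : (Fintype.card V : ℝ) ≤ 1 := by
        have : Fintype.card V ≤ 1 := by omega
        exact_mod_cast this
      have := hmean_le 1 h1
      rw [Nat.cast_zero, mul_zero, add_zero]
      linarith
    · have hD' : (0 : ℝ) < D := by exact_mod_cast hD
      have := mul_lt_mul_of_pos_right hC1 hD'
      linarith
  · rcases le_total 1 ε with h1 | h1
    · exact measureReal_le_one.trans h1
    · set y : ℝ := D + Real.logb 2 (1 / ε) with hy
      -- Since κ^C = 1/8, this level gives the bound 8^D·8^(-y) = ε³ ≤ ε.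
      have htail := exec.measure_requests_le hm acyclic source outdegree critical (m * (C * y))
      have hset : {ω | (Fintype.card V : ℝ) / m + C * y + 1 ≤ makespan state ω} ⊆
          {ω | m * (C * y) + m ≤ (config state (Fintype.card V) ω).requests} := fun ω hω => by
        simp only [Set.mem_ofPred_eq] at hω ⊢
        rw [hreq]
        have := mul_le_mul_of_nonneg_left hω hm0.le
        rw [mul_add, mul_add, mul_div_cancel₀ _ hm0.ne'] at this
        linarith
      refine ENNReal.toReal_le_of_le_ofReal hε.le
        ((measure_mono hset).trans (htail.trans (ENNReal.ofReal_le_ofReal ?_)))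
      have hrun : (0 : ℝ) < runPotential D := by exact_mod_cast runPotential_pos D
      rw [mul_div_cancel_left₀ _ hm0.ne', ← Real.log_le_log_iff
        (mul_pos hrun (Real.rpow_pos_of_pos stealFactor_pos _)) hε,
        Real.log_mul hrun.ne' (Real.rpow_pos_of_pos stealFactor_pos _).ne',
        Real.log_rpow stealFactor_pos]
      have h2 : C * y * Real.log stealFactor = -(3 * Real.log 2 * y) := by
        rw [hC3]
        linear_combination 3 * Real.log 2 * y * requestCost_mul_log_stealFactor
      have h3 : Real.log 2 * Real.logb 2 (1 / ε) = -Real.log ε := by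
        rw [Real.logb, one_div, Real.log_inv]
        have : Real.log 2 ≠ 0 := (Real.log_pos one_lt_two).ne'
        field_simp
      have h4 := log_runPotential_le D
      have h5 : Real.log ε ≤ 0 := Real.log_nonpos hε.le h1
      have h6 : 3 * Real.log 2 * y = 3 * Real.log 2 * D - 3 * Real.log ε := by
        rw [hy]
        linear_combination 3 * h3
      linarith
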